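/- Let $\mathbb H^3$ be hyperbolic 3-space with sphere at infinity $S^2_\infty$. For a torsion-free discrete group $\Gamma$ of isometries of $\mathbb H^3$, let $L_\Gamma\subset S^2_\infty$ be its limit set and $\Omega(\Gamma)=S^2_\infty\setminus L_\Gamma$ its domain of discontinuity, and put $\overline M=(\mathbb H^3\cup\Omega(\Gamma))/\Gamma$, a 3-manifold with interior $M=\mathbb H^3/\Gamma$ and boundary the conformal boundary $\Omega(\Gamma)/\Gamma$. If $\Gamma$ is not abelian and $L_\Gamma$ has more than one point, $\Omega(\Gamma)/\Gamma$ carries the hyperbolic (Poincaré) metric that it inherits from $\Omega(\Gamma)$. A meridian is a simple closed curve in $\Omega(\Gamma)/\Gamma$ that is homotopically nontrivial in $\Omega(\Gamma)/\Gamma$ but trivial in $\overline M$; a compression disk bounded by a meridian $m$ is an embedded closed disk $D\subset\overline M$ with boundary curve $m$ and interior in $M$. A closed geodesic $\gamma$ of $M$ is said to cross $D$ essentially if some lift of $\gamma$ to $\mathbb H^3$ passes from one side of some lift $\widetilde D\subset\mathbb H^3\cup\Omega(\Gamma)$ of $D$ to the other, that is, if the two ends of that lift of $\gamma$ lie in different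 components of $\mathbb H^3\setminus\widetilde D$. **Lemma.** There is a function $K:\mathbb R\to\mathbb R$ with $K(\epsilon)\to\infty$ as $\epsilon\to0^+$ and with the following property. Let $\Gamma$ be any non-abelian torsion-free discrete group of isometries of $\mathbb H^3$, let $m$ be a meridian of $M=\mathbb H^3/\Gamma$, and let $D$ be any compression disk bounded by $m$. If the length of $m$ in the hyperbolic metric of the conformal boundary is $\epsilon>0$, then every closed geodesic of $M$ that crosses $D$ essentially has length greater than $K(\epsilon)$. -/

import Mathlib

open Set Filter Topology
open scoped ENNReal

noncomputable section

namespace HypThree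

/-! ## Hyperbolic 3-space in the ball model, its compactification and its isometries -/

/-- The closed unit ball in Euclidean 3-space, i.e. the compactification `H³ ∪ S²`. -/
abbrev CBall : Type := Metric.closedBall (0 : EuclideanSpace ℝ (Fin 3)) 1

/-- Hyperbolic space `H³`: the open unit ball. -/
def H3 : Set CBall := {x | ‖(x : EuclideanSpace ℝ (Fin 3))‖ < 1}

/-- The sphere at infinity `S²`. -/
def sphereInf : Set CBall := {x | ‖(x : EuclideanSpace ℝ (Fin 3))‖ = 1}

/-- The centre of the ball, used as base point. -/
def origin : CBall := ⟨0, by simp⟩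

/-- The hyperbolic distance (curvature `-1`) in the ball model, meaningful for points of `H3`. -/
def hdist (x y : CBall) : ℝ :=
  2 * Real.arsinh (dist x y /
    Real.sqrt ((1 - ‖(x : EuclideanSpace ℝ (Fin 3))‖ ^ 2) *
      (1 - ‖(y : EuclideanSpace ℝ (Fin 3))‖ ^ 2)))

/-- The isometry group of `H³`. Every isometry of `H³` extends in exactly one way to a
homeomorphism of the closed ball; it is represented here by that extension. -/
def IsoH3 : Subgroup (CBall ≃ₜ CBall) where
  carrier := {g | (∀ x, g x ∈ H3 ↔ x ∈ H3) ∧ ∀ x ∈ H3, ∀ y ∈ H3, hdist (g x) (g y) = hdist x y}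
  one_mem' := ⟨fun _ => Iff.rfl, fun _ _ _ _ => rfl⟩
  mul_mem' := by
    rintro a b ⟨ha, ha'⟩ ⟨hb, hb'⟩
    refine ⟨fun x => (ha (b x)).trans (hb x), fun x hx y hy => ?_⟩
    exact (ha' _ ((hb x).2 hx) _ ((hb y).2 hy)).trans (hb' x hx y hy)
  inv_mem' := by
    rintro a ⟨ha, ha'⟩
    have key : ∀ x, a ((a⁻¹ : CBall ≃ₜ CBall) x) = x := fun x => a.apply_symm_apply x
    have hmem : ∀ x, (a⁻¹ : CBall ≃ₜ CBall) x ∈ H3 ↔ x ∈ H3 := fun x => by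
      rw [← ha, key]
    refine ⟨hmem, fun x hx y hy => ?_⟩
    rw [← ha' _ ((hmem x).2 hx) _ ((hmem y).2 hy), key, key]

/-- Isometries act on the closed ball. -/
instance : MulAction IsoH3 CBall where
  smul g x := (g : CBall ≃ₜ CBall) x
  one_smul _ := rfl
  mul_smul _ _ _ := rfl

theorem smul_def (g : IsoH3) (x : CBall) : g • x = (g : CBall ≃ₜ CBall) x := rfl

/-- A discrete group of isometries of `H³`: it acts properly discontinuously on `H³`. -/
def IsDiscreteGroup (Γ : Subgroup IsoH3) : Prop :=
  ∀ x ∈ H3, ∀ R : ℝ, {g : IsoH3 | g ∈ Γ ∧ hdist x (g • x) ≤ R}.Finite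

/-- No element of `Γ` other than the identity has finite order. -/
def IsTorsionFreeGroup (Γ : Subgroup IsoH3) : Prop :=
  ∀ g ∈ Γ, ∀ n : ℕ, n ≠ 0 → g ^ n = 1 → g = 1

/-! ## Limit set, the manifold `(H³ ∪ Ω) / Γ` and its conformal boundary -/

/-- The limit set: the accumulation set on `S²` of an orbit of `Γ` in `H³`. -/
def limitSet (Γ : Subgroup IsoH3) : Set CBall :=
  sphereInf ∩ closure {x | ∃ g ∈ Γ, x = g • origin}

theorem smul_mem_sphereInf_iff (g : IsoH3) (x : CBall) : g • x ∈ sphereInf ↔ x ∈ sphereInf := by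
  have h : ∀ y : CBall, y ∈ sphereInf ↔ y ∉ H3 := fun y => by
    have hy : ‖(y : EuclideanSpace ℝ (Fin 3))‖ ≤ 1 := mem_closedBall_zero_iff.1 y.2
    change ‖(y : EuclideanSpace ℝ (Fin 3))‖ = 1 ↔ ¬ ‖(y : EuclideanSpace ℝ (Fin 3))‖ < 1
    rw [not_lt]
    exact ⟨fun e => e.ge, fun e => le_antisymm hy e⟩
  rw [h, h, smul_def, g.2.1]

theorem smul_mem_limitSet {Γ : Subgroup IsoH3} {g : IsoH3} (hg : g ∈ Γ) {x : CBall}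
    (hx : x ∈ limitSet Γ) : g • x ∈ limitSet Γ := by
  refine ⟨(smul_mem_sphereInf_iff g x).2 hx.1, ?_⟩
  refine map_mem_closure (g : CBall ≃ₜ CBall).continuous hx.2 ?_
  rintro _ ⟨h, hh, rfl⟩
  exact ⟨g * h, Γ.mul_mem hg hh, rfl⟩

/-- The domain of discontinuity `Ω(Γ) = S² \ L_Γ`. -/
def domainOfDiscontinuity (Γ : Subgroup IsoH3) : Set CBall := sphereInf \ limitSet Γ

/-- `H³ ∪ Ω(Γ)` (the closed ball minus the limit set), with its action of `Γ`. -/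
def bordification (Γ : Subgroup IsoH3) : SubMulAction Γ CBall where
  carrier := (limitSet Γ)ᶜ
  smul_mem' := by
    intro g x hx hgx
    apply hx
    have := smul_mem_limitSet (Γ.inv_mem g.2) hgx
    rwa [show ((g : Γ) • x : CBall) = (g : IsoH3) • x from rfl, inv_smul_smul] at this

/-- The 3-manifold with boundary `(H³ ∪ Ω(Γ)) / Γ`, with the quotient topology. Its interior is
`H³ / Γ`. -/
abbrev MBar (Γ : Subgroup IsoH3) : Type := MulAction.orbitRel.Quotient Γ (bordification Γ)

/-- The projection `H³ ∪ Ω(Γ) → (H³ ∪ Ω(Γ)) / Γ`. -/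
def proj (Γ : Subgroup IsoH3) (x : bordification Γ) : MBar Γ := Quotient.mk _ x

/-- The hyperbolic 3-manifold `H³ / Γ` inside `(H³ ∪ Ω(Γ)) / Γ`. -/
def hypManifold (Γ : Subgroup IsoH3) : Set (MBar Γ) := proj Γ '' {x | (x : CBall) ∈ H3}

/-- The conformal boundary `Ω(Γ) / Γ` inside `(H³ ∪ Ω(Γ)) / Γ`. -/
def conformalBoundary (Γ : Subgroup IsoH3) : Set (MBar Γ) :=
  proj Γ '' {x | (x : CBall) ∈ sphereInf}

/-- A point of the domain of discontinuity as a point of `H³ ∪ Ω(Γ)`. -/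
def ofDomain {Γ : Subgroup IsoH3} (x : domainOfDiscontinuity Γ) : bordification Γ := ⟨x, x.2.2⟩

/-! ## Hyperbolic length of curves in the conformal boundary -/

/-- A conformal universal covering, by the hyperbolic plane, of a component of `Ω(Γ)`. -/
def IsUniformization (Γ : Subgroup IsoH3) (f : UpperHalfPlane → domainOfDiscontinuity Γ) : Prop :=
  IsCoveringMap f ∧
    ∀ z : UpperHalfPlane,
      ConformalAt (fun w : ℂ => ((f (UpperHalfPlane.ofComplex w) : CBall) :
        EuclideanSpace ℝ (Fin 3))) (z : ℂ)

/-- The length of a closed curve `m` in `Ω(Γ) / Γ` for the hyperbolic metric: the length in the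
hyperbolic plane of a lift of `m` through a conformal universal covering. All pairs of a covering
and a lift give the same value, so the infimum only selects it. -/
def conformalLength {Γ : Subgroup IsoH3} (m : C(Circle, conformalBoundary Γ)) : ℝ≥0∞ :=
  ⨅ (f : UpperHalfPlane → domainOfDiscontinuity Γ) (_ : IsUniformization Γ f)
    (c : C(unitInterval, UpperHalfPlane))
    (_ : ∀ t : unitInterval,
      proj Γ (ofDomain (f (c t))) = (m (Circle.exp (2 * Real.pi * (t : ℝ))) : MBar Γ)),
    eVariationOn c univ

/-! ## Meridians, compression disks and closed geodesics -/

/-- A meridian: a simple closed curve in the boundary of `(H³ ∪ Ω(Γ)) / Γ` which is homotopically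
nontrivial in the boundary but trivial in the 3-manifold. -/
def IsMeridian {Γ : Subgroup IsoH3} (m : C(Circle, conformalBoundary Γ)) : Prop :=
  Function.Injective m ∧ ¬ m.Nullhomotopic ∧
    ((⟨Subtype.val, continuous_subtype_val⟩ : C(conformalBoundary Γ, MBar Γ)).comp m).Nullhomotopic

/-- The closed unit disk in the plane. -/
abbrev Disk : Type := Metric.closedBall (0 : ℂ) 1

/-- `D` is a compression disk bounded by `m`: an embedded closed disk, with interior in `H³ / Γ`
and with boundary curve `m`. -/
def IsCompressionDisk {Γ : Subgroup IsoH3} (m : C(Circle, conformalBoundary Γ))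
    (D : C(Disk, MBar Γ)) : Prop :=
  Function.Injective D ∧
    (∀ z : Disk, ‖(z : ℂ)‖ < 1 → D z ∈ hypManifold Γ) ∧
    ∀ (z : Disk) (u : Circle), (z : ℂ) = (u : ℂ) → D z = m u

/-- A complete geodesic line of `H³`, parametrized by arc length. -/
def IsGeodesicLine {Γ : Subgroup IsoH3} (c : ℝ → bordification Γ) : Prop :=
  (∀ t, (c t : CBall) ∈ H3) ∧ ∀ s t, hdist (c s) (c t) = |s - t|

/-- `γ` is a closed geodesic of `H³ / Γ` of length `l`, parametrized by arc length. -/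
def IsClosedGeodesic {Γ : Subgroup IsoH3} (γ : ℝ → MBar Γ) (l : ℝ) : Prop :=
  0 < l ∧ (∀ t, γ (t + l) = γ t) ∧
    ∃ c : ℝ → bordification Γ, IsGeodesicLine c ∧ ∀ t, proj Γ (c t) = γ t

/-- The complement in `H³` of (the image of) a disk in `H³ ∪ Ω(Γ)`. -/
def diskComplement {Γ : Subgroup IsoH3} (D' : C(Disk, bordification Γ)) : Set CBall :=
  {x | x ∈ H3 ∧ ∀ z : Disk, (D' z : CBall) ≠ x}

/-- The geodesic `γ` crosses the disk `D`: some lift of `γ` to `H³` passes from one side of some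
lift `D'` of `D` to the other, i.e. its two ends lie in different components of `H³ \ D'`. -/
def Crosses {Γ : Subgroup IsoH3} (γ : ℝ → MBar Γ) (D : C(Disk, MBar Γ)) : Prop :=
  ∃ (D' : C(Disk, bordification Γ)) (c : ℝ → bordification Γ),
    (∀ z, proj Γ (D' z) = D z) ∧ IsGeodesicLine c ∧ (∀ t, proj Γ (c t) = γ t) ∧
    ∃ T : ℝ, ∀ s < -T, ∀ t > T,
      (c s : CBall) ∈ diskComplement D' ∧ (c t : CBall) ∈ diskComplement D' ∧
        (c t : CBall) ∉ connectedComponentIn (diskComplement D') (c s)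

end HypThree

end

open HypThree

namespace HypThree

/-! ## Continuous logarithms -/

/-! Lift the geodesic to an axis with ends `a`, `b`, translated through `l` by some `g ∈ Γ`, and let
`S` be a stereographic coordinate on the sphere with zero `a` and pole `b`. If the disk separates
the ends, its boundary loop must wind around `0` in this coordinate, so a logarithm of `S` changes
along the loop by a nonzero multiple of `2πi`. On the other hand the logarithm varies slowly. Pulled
back by a uniformization `f` of a component of `Ω(Γ)`, it is a holomorphic or antiholomorphic
function `F` on the half-plane. Since `Γ` is not abelian there is a third limit point `p`; the
points `g ^ n • p` are missed by `f` and have moduli `exp (n * l) * ‖S p‖` in the coordinate. So `F`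
omits an `(l + 2π)`-dense set, and a Bloch type theorem bounds its hyperbolic derivative by a
constant times `l + 2π`. Along a loop of length about `ε` this gives `2π ≤ C (l + 2π) ε`, so `l` is
at least of order `1 / ε`. The topological half is `not_isBounded_connectedComponentIn_of_log` and
`exists_isPreconnected_of_log`; the analytic half is `mul_norm_deriv_le_of_omits_net` and
`exists_log_uniformization`. Isometries enter only through the conformal distortion rule
`dist_smul_sq`, which is also valid on the sphere. -/

theorem exists_continuousOn_log {E : Type*} [NormedAddCommGroup E] [NormedSpace ℝ E] {U : Set E}
    (hU : IsOpen U) (hc : Convex ℝ U) (hne : U.Nonempty) {g : E → ℂ} (hg : ContinuousOn g U)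
    (h0 : ∀ x ∈ U, g x ≠ 0) : ∃ G : E → ℂ, ContinuousOn G U ∧ ∀ x ∈ U, Complex.exp (G x) = g x := by
  have := hc.contractibleSpace hne
  have hs : IsSimplyConnected U := inferInstanceAs (SimplyConnectedSpace U)
  obtain ⟨G, hG, hG'⟩ := Complex.exists_continuousOn_eqOn_exp_comp hs hU hg
    (by rintro ⟨x, hx, h⟩; exact h0 x hx h)
  exact ⟨G, hG, fun x hx => hG' hx⟩

/-- The values lie in the discrete set `2πiℤ`, so `g` is locally constant. All comparisons of
winding numbers below rest on this. -/
theorem eq_of_exp_eq_one_of_isPreconnected {X : Type*} [TopologicalSpace X] {S : Set X}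
    (hS : IsPreconnected S) {g : X → ℂ} (hg : ContinuousOn g S)
    (h1 : ∀ x ∈ S, Complex.exp (g x) = 1) {x y : X} (hx : x ∈ S) (hy : y ∈ S) : g x = g y := by
  refine hS.induction₂ (fun x y => g x = g y) ?_ (fun x y z _ _ _ h h' => h.trans h')
    (fun x y _ _ h => h.symm) hx hy
  intro x hx
  have h := (hg x hx) (Metric.ball_mem_nhds (g x) one_pos)
  filter_upwards [h, self_mem_nhdsWithin] with y hy hyS
  have e : Complex.exp (g y - g x) = 1 := by rw [Complex.exp_sub, h1 x hx, h1 y hyS, div_one]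
  obtain ⟨n, hn⟩ := Complex.exp_eq_one_iff.1 e
  have hlt : ‖g y - g x‖ < 1 := by simpa [dist_eq_norm] using hy
  rw [hn] at hlt
  have hn0 : n = 0 := by
    by_contra h0
    have h1 : (1 : ℝ) ≤ |(n : ℝ)| := by exact_mod_cast Int.one_le_abs h0
    have : ‖(n : ℂ) * (2 * Real.pi * Complex.I)‖ = |(n : ℝ)| * (2 * Real.pi) := by
      simp [abs_of_pos Real.pi_pos]
    rw [this] at hlt
    nlinarith [Real.pi_gt_three]
  rw [hn0] at hn
  have : g y - g x = 0 := by simpa using hn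
  exact (sub_eq_zero.1 this).symm

/-- A no-retraction statement: a zero-free map of the whole plane has a logarithm, whereas the
identity of a circle around `0` has none, since `log R + it` gains `2πi` in one turn. -/
theorem not_exists_log_of_eq_id_outside {r : ℂ → ℂ} (hr : Continuous r) (h0 : ∀ z, r z ≠ 0) {R : ℝ}
    (hR : 0 < R) (hid : ∀ z, ‖z‖ = R → r z = z) : False := by
  obtain ⟨ψ, hψ, hψ'⟩ := exists_continuousOn_log isOpen_univ convex_univ univ_nonempty
    hr.continuousOn (fun z _ => h0 z)
  rw [continuousOn_univ] at hψ
  set g : ℝ → ℂ := fun t => ψ (R * Complex.exp (t * Complex.I)) - Complex.log R - t * Complex.I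
    with hgdef
  have hg : Continuous g := by fun_prop
  have h1 : ∀ t, Complex.exp (g t) = 1 := by
    intro t
    have hR' : (R : ℂ) ≠ 0 := by exact_mod_cast hR.ne'
    rw [hgdef]
    simp only [Complex.exp_sub]
    rw [hψ' _ (mem_univ _), hid _ (by simp [Complex.norm_exp, abs_of_pos hR]), Complex.exp_log hR']
    field_simp
  have := eq_of_exp_eq_one_of_isPreconnected isPreconnected_univ hg.continuousOn
    (fun t _ => h1 t) (mem_univ 0) (mem_univ (2 * Real.pi))
  simp only [hgdef, Complex.ofReal_zero, zero_mul, Complex.exp_zero, Complex.ofReal_mul,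
    Complex.ofReal_ofNat, Complex.exp_two_pi_mul_I, sub_zero] at this
  exact Complex.two_pi_I_ne_zero (by linear_combination this)

/-- Eilenberg's criterion: if the identity of a compact plane set `K` has a continuous logarithm,
then `0` lies in the unbounded component of the complement. -/
theorem not_isBounded_connectedComponentIn_of_log {K : Set ℂ} (hK : IsCompact K) (h0 : (0 : ℂ) ∉ K)
    (κ : C(K, ℂ)) (hκ : ∀ k : K, Complex.exp (κ k) = k) :
    ¬ Bornology.IsBounded (connectedComponentIn Kᶜ 0) := by
  intro hb
  classical
  set U := connectedComponentIn Kᶜ 0 with hU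
  have hUo : IsOpen U := hK.isClosed.isOpen_compl.connectedComponentIn
  -- The component of a frontier point outside `K` would be open, hence meet `U` and equal it; but
  -- the open set `U` misses its frontier.
  have hfr : frontier U ⊆ K := by
    intro x hx
    rw [hUo.frontier_eq] at hx
    by_contra hxK
    have hVo : IsOpen (connectedComponentIn Kᶜ x) := hK.isClosed.isOpen_compl.connectedComponentIn
    obtain ⟨y, hy1, hy2⟩ := mem_closure_iff.1 hx.1 _ hVo (mem_connectedComponentIn hxK)
    apply hx.2
    rw [hU, connectedComponentIn_eq hy2, ← connectedComponentIn_eq hy1]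
    exact mem_connectedComponentIn hxK
  obtain ⟨Φ, hΦ⟩ := ContinuousMap.exists_restrict_eq hK.isClosed κ
  have hΦ' : ∀ k ∈ K, Complex.exp (Φ k) = k := by
    intro k hk
    have := hκ ⟨k, hk⟩
    rwa [← hΦ] at this
  obtain ⟨R, hR, hR'⟩ := hb.exists_pos_norm_lt
  refine not_exists_log_of_eq_id_outside (r := U.piecewise (fun z => Complex.exp (Φ z)) id)
    (Continuous.piecewise (fun a ha => hΦ' a (hfr ha)) (by fun_prop) continuous_id) ?_ hR ?_
  · intro z
    by_cases hz : z ∈ U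
    · simp [hz]
    · simp only [hz, not_false_eq_true, piecewise_eq_of_notMem, id_eq]
      rintro rfl
      exact hz (mem_connectedComponentIn h0)
  · intro z hz
    rw [piecewise_eq_of_notMem _ _ _ (fun h => (hR' z h).ne hz)]
    rfl

/-! ## Conformal locally injective plane maps -/

/-- A conformal real-linear map of the plane is complex linear or conjugate linear; conjugation
turns the second kind into the first. -/
theorem conformalAt_hasDerivAt_or {Φ : ℂ → ℂ} {z : ℂ} (h : ConformalAt Φ z) :
    (∃ α ≠ 0, HasDerivAt Φ α z) ∨
      ∃ α ≠ 0, HasDerivAt (fun w => (starRingEnd ℂ) (Φ w)) α z := by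
  obtain ⟨L, hL, hc⟩ := h
  obtain ⟨⟨M, hM⟩ | ⟨M, hM⟩, hne⟩ := isConformalMap_iff_is_complex_or_conj_linear.1 hc
  · left
    refine ⟨M 1, fun h0 => hne ?_, ?_⟩
    · rw [← hM]
      ext v
      simpa [h0] using M.map_smul v 1
    · have : HasFDerivAt Φ M z := hasFDerivAt_of_restrictScalars ℝ hL hM
      exact this.hasDerivAt
  · right
    have hc' : HasFDerivAt (fun w => (starRingEnd ℂ) (Φ w))
        ((Complex.conjCLE : ℂ →L[ℝ] ℂ) ∘L L) z :=
      (Complex.conjCLE : ℂ →L[ℝ] ℂ).hasFDerivAt.comp z hL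
    have hl : ∀ v, L v = M (starRingEnd ℂ v) := by
      intro v
      have := congrArg (fun T : ℂ →L[ℝ] ℂ => T (starRingEnd ℂ v)) hM
      simpa using this.symm
    have hM1 : ∀ w, M w = w * M 1 := fun w => by simpa using M.map_smul w 1
    let N : ℂ →L[ℂ] ℂ := ContinuousLinearMap.toSpanSingleton ℂ (starRingEnd ℂ (M 1))
    have hN : N.restrictScalars ℝ = (Complex.conjCLE : ℂ →L[ℝ] ℂ) ∘L L := by
      ext v
      simp only [ContinuousLinearMap.coe_restrictScalars', ContinuousLinearMap.coe_comp,
        Function.comp_apply]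
      change v • _ = starRingEnd ℂ (L v)
      rw [hl, hM1 (starRingEnd ℂ v), map_mul, Complex.conj_conj, smul_eq_mul]
    have hd := (hasFDerivAt_of_restrictScalars ℝ hc' hN).hasDerivAt
    refine ⟨_, fun h0 => hne ?_, hd⟩
    have h0' : M 1 = 0 := by
      simpa [N, ContinuousLinearMap.toSpanSingleton_apply] using h0
    ext v
    rw [hl, hM1, h0', mul_zero]
    rfl

/-- Small circles around `z` wind once, positively, around `Φ z`: the quotient of `Φ (z + e) - Φ z`
by `α e` stays within distance `1` of `1`, where the principal logarithm is continuous. Winding is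
measured by an arbitrary continuous logarithm `g`, so that one constructed elsewhere can be
inserted. -/
theorem hasDerivAt_eventually_winding_eq {Φ : ℂ → ℂ} {z α : ℂ} (hα : α ≠ 0)
    (h : HasDerivAt Φ α z) : ∀ᶠ ρ : ℝ in 𝓝[>] 0, ∀ g : ℝ → ℂ, Continuous g →
      (∀ t : ℝ, Complex.exp (g t) = Φ (z + ρ * Complex.exp (t * Complex.I)) - Φ z) →
      g (2 * Real.pi) - g 0 = 2 * Real.pi * Complex.I := by
  have hlo := (hasDerivAt_iff_isLittleO_nhds_zero.1 h).def (c := ‖α‖ / 2)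
    (by positivity)
  obtain ⟨δ, hδ, hlo⟩ := Metric.eventually_nhds_iff.1 hlo
  filter_upwards [Ioo_mem_nhdsGT hδ] with ρ hρ g hg hexp
  have hρ0 : (ρ : ℂ) ≠ 0 := by exact_mod_cast hρ.1.ne'
  set e : ℝ → ℂ := fun t => ρ * Complex.exp (t * Complex.I) with he
  have hec : Continuous e := by fun_prop
  have he0 : ∀ t, α * e t ≠ 0 := fun t => mul_ne_zero hα (mul_ne_zero hρ0 (Complex.exp_ne_zero _))
  have hen : ∀ t, ‖e t‖ = ρ := fun t => by simp [he, Complex.norm_exp, abs_of_pos hρ.1]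
  set u : ℝ → ℂ := fun t => Complex.exp (g t) / (α * e t) with hu
  have huc : Continuous u := (Complex.continuous_exp.comp hg).div (continuous_const.mul hec) he0
  have hu1 : ∀ t, u t ∈ Complex.slitPlane := by
    intro t
    have h1 := hlo (y := e t) (by simpa [hen] using hρ.2)
    have h2 : u t - 1 = (Φ (z + e t) - Φ z - e t • α) / (α * e t) := by
      rw [hu]
      simp only [hexp]
      rw [sub_div _ (e t • α), smul_eq_mul, mul_comm (e t), div_self (he0 t)]
    have h3 : ‖u t - 1‖ < 1 := by
      rw [h2, norm_div, norm_mul, hen, div_lt_one (by have := hρ.1; positivity)]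
      rw [hen] at h1
      have := hρ.1
      have : 0 < ‖α‖ * ρ := by positivity
      linarith
    simpa using Complex.mem_slitPlane_of_norm_lt_one h3
  have hk : ∀ t : ℝ, Complex.exp (g t - t * Complex.I - Complex.log (α * ρ) - Complex.log (u t))
      = 1 := by
    intro t
    have hαρ : α * ρ ≠ 0 := mul_ne_zero hα hρ0
    rw [Complex.exp_sub, Complex.exp_sub, Complex.exp_sub, Complex.exp_log hαρ,
      Complex.exp_log (Complex.slitPlane_ne_zero (hu1 t))]
    have : Complex.exp (g t) = u t * (α * e t) := by
      rw [hu]; simp only; rw [div_mul_cancel₀ _ (he0 t)]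
    rw [this]
    simp only [he]
    have := Complex.slitPlane_ne_zero (hu1 t)
    field_simp
  have := eq_of_exp_eq_one_of_isPreconnected isPreconnected_univ
    (Continuous.continuousOn (by
      have := huc.clog hu1
      fun_prop)) (fun t _ => hk t) (mem_univ (2 * Real.pi)) (mem_univ 0)
  have huu : u (2 * Real.pi) = u 0 := by
    simp only [hu, hexp, he]
    simp [Complex.exp_two_pi_mul_I]
  rw [huu] at this
  push_cast at this
  linear_combination this

theorem not_conformalAt_of_deriv_eq_zero {Φ : ℂ → ℂ} {z : ℂ} (h0 : deriv Φ z = 0)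
    (hd : DifferentiableAt ℂ Φ z) : ¬ ConformalAt Φ z := by
  intro h
  have h1 := hd.hasDerivAt.hasFDerivAt.restrictScalars ℝ
  obtain ⟨L, hL, hc⟩ := h
  refine (isConformalMap_iff_is_complex_or_conj_linear.1 hc).2 ?_
  rw [hL.unique h1, h0]
  ext v
  simp

/-- `ConformalAt` gives derivatives pointwise, with no continuity, so orientation cannot be followed
through the sign of a determinant. Injectivity replaces it: `Φ (z + ρ e^{it}) - Φ z` never vanishes,
has a logarithm jointly in `(z, ρ, t)`, and its winding in `t` is therefore constant in `(z, ρ)`. It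
would be `2πi` at `z₁` and `-2πi` at an orientation-reversing `z₂`. -/
theorem differentiableAt_of_conformalAt_of_injOn {Φ : ℂ → ℂ} {c : ℂ} {r : ℝ}
    (hΦ : ContinuousOn Φ (Metric.ball c r)) (hinj : InjOn Φ (Metric.ball c r)) {z₁ z₂ : ℂ}
    (h1 : z₁ ∈ Metric.ball c (r / 2)) (h2 : z₂ ∈ Metric.ball c (r / 2)) (hc : ConformalAt Φ z₂)
    {α : ℂ} (hα : α ≠ 0) (hd : HasDerivAt Φ α z₁) : DifferentiableAt ℂ Φ z₂ := by
  obtain ⟨β, hβ, hβ'⟩ | ⟨β, hβ, hβ'⟩ := conformalAt_hasDerivAt_or hc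
  · exact hβ'.differentiableAt
  exfalso
  have hr : 0 < r / 2 := Metric.pos_of_mem_ball h1
  set X : Set (ℂ × ℝ × ℝ) := Metric.ball c (r / 2) ×ˢ Ioo 0 (r / 2) ×ˢ univ with hX
  have hXo : IsOpen X := Metric.isOpen_ball.prod (isOpen_Ioo.prod isOpen_univ)
  have hXc : Convex ℝ X := (convex_ball _ _).prod ((convex_Ioo _ _).prod convex_univ)
  have hXn : X.Nonempty := ⟨(z₁, r / 4, 0), h1, ⟨by linarith, by linarith⟩, trivial⟩
  set e : ℂ × ℝ × ℝ → ℂ := fun p => p.1 + p.2.1 * Complex.exp (p.2.2 * Complex.I) with he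
  have hee : ∀ p ∈ X, e p ∈ Metric.ball c r := by
    rintro ⟨z, ρ, t⟩ ⟨hz, hρ, -⟩
    have : dist (e (z, ρ, t)) z = ρ := by
      simp [he, dist_eq_norm, Complex.norm_exp, abs_of_pos hρ.1]
    have h' := dist_triangle (e (z, ρ, t)) z c
    simp only [Metric.mem_ball] at hz ⊢
    linarith [hρ.2]
  have hsub : Metric.ball c (r / 2) ⊆ Metric.ball c r := Metric.ball_subset_ball (by linarith)
  obtain ⟨G, hG, hG'⟩ := exists_continuousOn_log hXo hXc hXn
    (g := fun p => Φ (e p) - Φ p.1)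
    ((hΦ.comp (by fun_prop) hee).sub (hΦ.comp (by fun_prop) (fun p hp => hsub hp.1)))
    (by
      rintro ⟨z, ρ, t⟩ hp h0
      have := hinj (hee _ hp) (hsub hp.1) (sub_eq_zero.1 h0)
      simp [he, hp.2.1.1.ne'] at this)
  set Y : Set (ℂ × ℝ) := Metric.ball c (r / 2) ×ˢ Ioo 0 (r / 2) with hY
  have hYp : IsPreconnected Y := ((convex_ball _ _).prod (convex_Ioo _ _)).isPreconnected
  set W : ℂ × ℝ → ℂ := fun p => G (p.1, p.2, 2 * Real.pi) - G (p.1, p.2, 0) with hW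
  have hWc : ContinuousOn W Y :=
    (hG.comp (by fun_prop) (fun p hp => ⟨hp.1, hp.2, trivial⟩)).sub
      (hG.comp (by fun_prop) (fun p hp => ⟨hp.1, hp.2, trivial⟩))
  have hW1 : ∀ p ∈ Y, Complex.exp (W p) = 1 := by
    rintro ⟨z, ρ⟩ hp
    rw [hW]
    simp only
    have hx : (z, ρ, (2 * Real.pi : ℝ)) ∈ X := ⟨hp.1, hp.2, trivial⟩
    have hy : (z, ρ, (0 : ℝ)) ∈ X := ⟨hp.1, hp.2, trivial⟩
    have hne := Complex.exp_ne_zero (G (z, ρ, 0))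
    rw [Complex.exp_sub, div_eq_one_iff_eq hne, hG' _ hx, hG' _ hy]
    simp [he, Complex.exp_two_pi_mul_I]
  have hGt : ∀ z ∈ Metric.ball c (r / 2), ∀ ρ ∈ Ioo 0 (r / 2),
      Continuous (fun t : ℝ => G (z, ρ, t)) := fun z hz ρ hρ => by
    rw [← continuousOn_univ]
    exact hG.comp (by fun_prop) (fun t _ => ⟨hz, hρ, trivial⟩)
  obtain ⟨ρ₁, hw₁, hρ₁⟩ :=
    ((hasDerivAt_eventually_winding_eq hα hd).and (Ioo_mem_nhdsGT hr)).exists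
  obtain ⟨ρ₂, hw₂, hρ₂⟩ :=
    ((hasDerivAt_eventually_winding_eq hβ hβ').and (Ioo_mem_nhdsGT hr)).exists
  have e1 := hw₁ _ (hGt z₁ h1 ρ₁ hρ₁) (fun t => hG' (z₁, ρ₁, t) ⟨h1, hρ₁, trivial⟩)
  have e2 := hw₂ (fun t => starRingEnd ℂ (G (z₂, ρ₂, t)))
    (Complex.continuous_conj.comp (hGt z₂ h2 ρ₂ hρ₂))
    (fun t => by
      rw [Complex.exp_conj, hG' (z₂, ρ₂, t) ⟨h2, hρ₂, trivial⟩, map_sub])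
  have e3 := eq_of_exp_eq_one_of_isPreconnected hYp hWc hW1 (x := (z₁, ρ₁)) (y := (z₂, ρ₂))
    ⟨h1, hρ₁⟩ ⟨h2, hρ₂⟩
  simp only [hW] at e3
  rw [← map_sub, ← e3, e1] at e2
  simp only [map_mul, Complex.conj_I, Complex.conj_ofReal, map_ofNat] at e2
  exact Complex.two_pi_I_ne_zero (by linear_combination -e2 / 2)

/-- A locally injective conformal map of a connected plane domain is holomorphic or
antiholomorphic. -/
theorem differentiableOn_or_of_conformalAt {Φ : ℂ → ℂ} {U : Set ℂ} (hU : IsOpen U)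
    (hUc : IsPreconnected U) (hc : ∀ z ∈ U, ConformalAt Φ z)
    (hinj : ∀ z ∈ U, ∃ V ∈ 𝓝 z, InjOn Φ V) :
    DifferentiableOn ℂ Φ U ∨ DifferentiableOn ℂ (fun z => starRingEnd ℂ (Φ z)) U := by
  have hcont : ContinuousOn Φ U := fun z hz =>
    (hc z hz).differentiableAt.continuousAt.continuousWithinAt
  by_cases hex : ∃ z ∈ U, ∃ α ≠ 0, HasDerivAt Φ α z
  · left
    obtain ⟨z, hz, α, hα, hd⟩ := hex
    -- Preserving orientation is locally constant; the equivalence form supplies the symmetric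
    -- transitive relation that propagates along a preconnected set.
    have key : ∀ w ∈ U, (∃ α ≠ 0, HasDerivAt Φ α z) ↔ ∃ α ≠ 0, HasDerivAt Φ α w := by
      intro w hw
      refine hUc.induction₂
        (fun z w => (∃ α ≠ 0, HasDerivAt Φ α z) ↔ ∃ α ≠ 0, HasDerivAt Φ α w)
        ?_ (fun x y z _ _ _ h h' => h.trans h') (fun x y _ _ h => h.symm) hz hw
      intro x hx
      obtain ⟨V, hV, hVi⟩ := hinj x hx
      obtain ⟨r, hr, hrs⟩ := Metric.mem_nhds_iff.1 (Filter.inter_mem hV (hU.mem_nhds hx))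
      have up : ∀ p ∈ Metric.ball x (r / 2), ∀ q ∈ Metric.ball x (r / 2),
          (∃ α ≠ 0, HasDerivAt Φ α p) → ∃ α ≠ 0, HasDerivAt Φ α q := by
        rintro p hp q hq ⟨α, hα, hd⟩
        have hqU : q ∈ U := (hrs (Metric.ball_subset_ball (by linarith) hq)).2
        have hdq := differentiableAt_of_conformalAt_of_injOn
          (hcont.mono fun y hy => (hrs hy).2) (hVi.mono fun y hy => (hrs hy).1) hp hq
          (hc q hqU) hα hd
        refine ⟨deriv Φ q, fun h0 => ?_, hdq.hasDerivAt⟩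
        refine (not_conformalAt_of_deriv_eq_zero h0 hdq) (hc q hqU)
      have hmem : x ∈ Metric.ball x (r / 2) := Metric.mem_ball_self (by linarith)
      filter_upwards [mem_nhdsWithin_of_mem_nhds (Metric.ball_mem_nhds x (half_pos hr))] with y hy
      exact ⟨up x hmem y hy, up y hy x hmem⟩
    intro w hw
    obtain ⟨β, -, hβ⟩ := (key w hw).1 ⟨α, hα, hd⟩
    exact hβ.differentiableAt.differentiableWithinAt
  · right
    intro z hz
    obtain h | ⟨β, -, hβ⟩ := conformalAt_hasDerivAt_or (hc z hz)
    · exact absurd ⟨z, hz, h⟩ hex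
    · exact hβ.differentiableAt.differentiableWithinAt

/-! ## A Bloch type estimate -/

/-- A holomorphic function that omits an `R`-dense set of values has bounded derivative. -/
theorem mul_norm_deriv_le_of_omits_net {F : ℂ → ℂ} {U : Set ℂ} (hU : IsOpen U)
    (hF : DifferentiableOn ℂ F U) {z₀ : ℂ} {ρ R : ℝ} (hρ : 0 < ρ)
    (hsub : Metric.closedBall z₀ ρ ⊆ U)
    (hR : ∀ w : ℂ, ∃ v, ‖v - w‖ ≤ R ∧ ∀ z ∈ U, F z ≠ v) :
    ρ * ‖deriv F z₀‖ ≤ 48 * R := by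
  have hR0 : 0 ≤ R := by
    obtain ⟨v, hv, -⟩ := hR 0
    exact (norm_nonneg _).trans hv
  have hF' : DifferentiableOn ℂ (deriv F) U := hF.deriv hU
  have hd : ∀ z ∈ U, HasDerivAt F (deriv F z) z := fun z hz =>
    ((hF z hz).differentiableAt (hU.mem_nhds hz)).hasDerivAt
  -- Landau's device: at a maximum `p` of the derivative weighted by the distance to the boundary,
  -- `‖deriv F‖` is at most `2 * A` on the ball of radius `s`, half the remaining margin.
  obtain ⟨p, hp, hmax⟩ := (isCompact_closedBall z₀ ρ).exists_isMaxOn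
    ⟨z₀, Metric.mem_closedBall_self hρ.le⟩
    (f := fun z => (ρ - dist z z₀) * ‖deriv F z‖)
    ((continuousOn_const.sub (by fun_prop)).mul (hF'.continuousOn.mono hsub).norm)
  set A := ‖deriv F p‖ with hA
  have hM0 := hmax (Metric.mem_closedBall_self hρ.le)
  simp only [mem_ofPred_eq, dist_self, sub_zero] at hM0
  refine hM0.trans ?_
  set s := (ρ - dist p z₀) / 2 with hs
  have hpz : dist p z₀ ≤ ρ := hp
  have hs0 : 0 ≤ s := by rw [hs]; linarith
  obtain h0 | hpos := (mul_nonneg hs0 (norm_nonneg (deriv F p))).eq_or_lt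
  · have : (ρ - dist p z₀) * ‖deriv F p‖ = 2 * (s * ‖deriv F p‖) := by rw [hs]; ring
    rw [this, ← h0]
    linarith
  have hApos : 0 < A := pos_of_mul_pos_right hpos hs0
  have hspos : 0 < s := pos_of_mul_pos_left hpos (norm_nonneg _)
  have hsubs : Metric.ball p s ⊆ Metric.closedBall z₀ ρ := fun z hz => by
    have h' := dist_triangle z p z₀
    simp only [Metric.mem_ball, Metric.mem_closedBall] at hz ⊢
    linarith
  have hbound : ∀ z ∈ Metric.ball p s, ‖deriv F z‖ ≤ 2 * A := by
    intro z hz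
    have h1 := hmax (hsubs hz)
    simp only [mem_ofPred_eq] at h1
    have h2 : s ≤ ρ - dist z z₀ := by
      have h' := dist_triangle z p z₀
      simp only [Metric.mem_ball] at hz
      linarith
    have h3 : s * ‖deriv F z‖ ≤ s * (2 * A) :=
      calc s * ‖deriv F z‖ ≤ (ρ - dist z z₀) * ‖deriv F z‖ := by gcongr
        _ ≤ (ρ - dist p z₀) * A := h1
        _ = s * (2 * A) := by rw [hs]; ring
    exact le_of_mul_le_mul_left h3 hspos
  -- Schwarz lemma for `deriv F - deriv F p`, bounded by `2A + A`.
  have hschwarz : ∀ z ∈ Metric.ball p s, ‖deriv F z - deriv F p‖ ≤ 3 * A / s * ‖z - p‖ := by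
    intro z hz
    have := Complex.dist_le_div_mul_dist_of_mapsTo_ball (R₂ := 3 * A)
      (hF'.mono (hsubs.trans hsub)) (fun w hw => by
        rw [mem_closedBall_iff_norm]
        have := norm_sub_le (deriv F w) (deriv F p)
        linarith [hbound w hw]) hz
    simpa [dist_eq_norm] using this
  have hsub6 : Metric.closedBall p (s / 6) ⊆ Metric.ball p s :=
    Metric.closedBall_subset_ball (by linarith)
  -- At radius `s / 6` the derivative has varied by at most `A / 2`, so `F` moves by at least `A (s
  -- / 6) - (A / 2) (s / 6) = A s / 12`.
  have hlower : ∀ z ∈ Metric.sphere p (s / 6), A * s / 12 ≤ ‖F z - F p‖ := by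
    intro z hz
    have hzc := Metric.sphere_subset_closedBall hz
    have hG : ∀ w ∈ Metric.closedBall p (s / 6), HasDerivWithinAt (fun w => F w - deriv F p * w)
        (deriv F w - deriv F p) (Metric.closedBall p (s / 6)) w := by
      intro w hw
      have : HasDerivAt (fun w => F w - deriv F p * w) (deriv F w - deriv F p * 1) w :=
        (hd w (hsub (hsubs (hsub6 hw)))).sub ((hasDerivAt_id w).const_mul (deriv F p))
      rw [mul_one] at this
      exact this.hasDerivWithinAt
    have hb := Convex.norm_image_sub_le_of_norm_hasDerivWithin_le (C := A / 2) hG (fun w hw => by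
        refine (hschwarz w (hsub6 hw)).trans ?_
        have : ‖w - p‖ ≤ s / 6 := mem_closedBall_iff_norm.1 hw
        calc 3 * A / s * ‖w - p‖ ≤ 3 * A / s * (s / 6) := by gcongr
          _ = A / 2 := by field_simp; norm_num)
      (convex_closedBall _ _) (Metric.mem_closedBall_self (by linarith)) hzc
    have hzn : ‖z - p‖ = s / 6 := mem_sphere_iff_norm.1 hz
    have h1 : F z - deriv F p * z - (F p - deriv F p * p)
        = (F z - F p) - deriv F p * (z - p) := by ring
    rw [h1] at hb
    have h2 := norm_sub_norm_le (deriv F p * (z - p)) (F z - F p)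
    rw [norm_sub_rev (deriv F p * (z - p)), norm_mul, hzn, ← hA] at h2
    rw [hzn] at hb
    linarith
  have hne : ∃ᶠ z in 𝓝 p, F z ≠ F p :=
    ((hd p (hsub hp)).eventually_ne (c := F p) (norm_pos_iff.1 hApos)).frequently.filter_mono
      nhdsWithin_le_nhds
  -- The quantitative open mapping theorem covers a ball of radius `A s / 24`, so `R ≥ A s / 24`;
  -- the weighted maximum is `2 s A`, whence `48`.
  have himg := DiffContOnCl.ball_subset_image_closedBall (f := F) (r := s / 6) (ε := A * s / 12)
    (DifferentiableOn.diffContOnCl (by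
      rw [closure_ball _ (by positivity)]
      exact hF.mono (hsub6.trans (hsubs.trans hsub)))) (by positivity) hlower hne
  by_contra hcon
  push Not at hcon
  have hRlt : R < A * s / 12 / 2 := by
    have : (ρ - dist p z₀) * A = 2 * (s * A) := by rw [hs]; ring
    rw [this] at hcon
    linarith
  obtain ⟨v, hv, hv'⟩ := hR (F p)
  obtain ⟨z, hz, hzv⟩ := himg (mem_ball_iff_norm.2 (hv.trans_lt hRlt))
  exact hv' z (hsub (hsubs (hsub6 hz))) hzv

/-- The hyperbolic distance travelled in the half-plane bounds the change of the logarithm of a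
holomorphic function omitting values of moduli `exp (n * l) * r`, `n ∈ ℤ`. -/
theorem norm_log_sub_le_of_omits {F : ℂ → ℂ} (hF : DifferentiableOn ℂ F {z | 0 < z.im}) {l r : ℝ}
    (hl : 0 < l) (hr : 0 < r)
    (homit : ∀ n : ℤ, ∃ v : ℂ, ‖v‖ = Real.exp (n * l) * r ∧
      ∀ z : ℂ, 0 < z.im → Complex.exp (F z) ≠ v)
    {z w : ℂ} (hz : 0 < z.im) (hzw : ‖w - z‖ ≤ z.im / 2) :
    ‖F w - F z‖ * z.im ≤ 192 * (l + 2 * Real.pi) * ‖w - z‖ := by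
  have hU : IsOpen {z : ℂ | 0 < z.im} := isOpen_lt continuous_const Complex.continuous_im
  have hnet : ∀ w : ℂ, ∃ v, ‖v - w‖ ≤ l + 2 * Real.pi ∧ ∀ z ∈ {z : ℂ | 0 < z.im}, F z ≠ v := by
    intro w
    obtain ⟨v, hv, hv'⟩ := homit ⌊(w.re - Real.log r) / l⌋
    have hvpos : 0 < ‖v‖ := by rw [hv]; positivity
    have hv0 : v ≠ 0 := norm_pos_iff.1 hvpos
    -- Logarithms of omitted values: the integer `n` brings the real part within `l` of that of `w`,
    -- and the branch brings the imaginary part within `2π`.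
    refine ⟨Complex.log v + ⌊(w.im - (Complex.log v).im) / (2 * Real.pi)⌋ *
      (2 * Real.pi * Complex.I), ?_, fun z hz h => hv' z hz ?_⟩
    · refine (Complex.norm_le_abs_re_add_abs_im _).trans (add_le_add ?_ ?_)
      · have h1 := Int.floor_le ((w.re - Real.log r) / l)
        have h2 := Int.lt_floor_add_one ((w.re - Real.log r) / l)
        rw [le_div_iff₀ hl] at h1
        rw [div_lt_iff₀ hl] at h2
        have : (Complex.log v).re = ⌊(w.re - Real.log r) / l⌋ * l + Real.log r := by
          rw [Complex.log_re, hv, Real.log_mul (Real.exp_pos _).ne' hr.ne', Real.log_exp]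
        simp only [Complex.sub_re, Complex.add_re, Complex.mul_re, Complex.intCast_re,
          Complex.intCast_im, Complex.I_re, Complex.I_im, Complex.re_ofNat, Complex.ofReal_re,
          Complex.ofReal_im, Complex.im_ofNat, Complex.mul_im]
        rw [this, abs_le]
        constructor <;> linarith
      · have hpi := Real.two_pi_pos
        have h1 := Int.floor_le ((w.im - (Complex.log v).im) / (2 * Real.pi))
        have h2 := Int.lt_floor_add_one ((w.im - (Complex.log v).im) / (2 * Real.pi))
        rw [le_div_iff₀ hpi] at h1
        rw [div_lt_iff₀ hpi] at h2
        simp only [Complex.sub_im, Complex.add_im, Complex.mul_re, Complex.intCast_re,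
          Complex.intCast_im, Complex.I_re, Complex.I_im, Complex.re_ofNat, Complex.ofReal_re,
          Complex.ofReal_im, Complex.im_ofNat, Complex.mul_im]
        rw [abs_le]
        constructor <;> linarith
    · rw [h, Complex.exp_add, Complex.exp_log hv0, Complex.exp_int_mul_two_pi_mul_I, mul_one]
  set R := l + 2 * Real.pi with hRdef
  have hball : ∀ p ∈ Metric.closedBall z (z.im / 2), z.im / 2 ≤ p.im := by
    intro p hp
    have h1 := (Complex.abs_im_le_norm (p - z)).trans (mem_closedBall_iff_norm.1 hp)
    rw [Complex.sub_im] at h1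
    linarith [(abs_le.1 h1).1]
  have hderiv : ∀ p ∈ Metric.closedBall z (z.im / 2), ‖deriv F p‖ ≤ 192 * R / z.im := by
    intro p hp
    have hp2 := hball p hp
    -- Since `p.im ≥ z.im / 2`, the ball of radius `z.im / 4` stays in the half-plane; `192 = 4 ·
    -- 48`.
    have h1 := mul_norm_deriv_le_of_omits_net (ρ := z.im / 4) hU hF (z₀ := p) (by positivity)
      (fun q hq => by
        have h1 := (Complex.abs_im_le_norm (q - p)).trans (mem_closedBall_iff_norm.1 hq)
        rw [Complex.sub_im] at h1
        change 0 < q.im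
        linarith [(abs_le.1 h1).1]) hnet
    rw [le_div_iff₀ hz]
    linarith
  have := Convex.norm_image_sub_le_of_norm_deriv_le (𝕜 := ℂ) (f := F)
    (fun p hp => (hF p (show 0 < p.im by linarith [hball p hp])).differentiableAt
      (hU.mem_nhds (show 0 < p.im by linarith [hball p hp]))) hderiv (convex_closedBall z (z.im / 2))
    (Metric.mem_closedBall_self (by positivity)) (mem_closedBall_iff_norm.2 hzw)
  calc ‖F w - F z‖ * z.im ≤ (192 * R / z.im * ‖w - z‖) * z.im := by gcongr
    _ = _ := by field_simp

/-! ## Isometries in the ball model -/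

/-- The defining function `1 - ‖x‖²` of the closed ball. -/
noncomputable def gap (x : CBall) : ℝ := 1 - ‖(x : EuclideanSpace ℝ (Fin 3))‖ ^ 2

theorem norm_coe_le (x : CBall) : ‖(x : EuclideanSpace ℝ (Fin 3))‖ ≤ 1 :=
  mem_closedBall_zero_iff.1 x.2

theorem gap_nonneg (x : CBall) : 0 ≤ gap x := by
  have := norm_coe_le x
  have := norm_nonneg (x : EuclideanSpace ℝ (Fin 3))
  unfold gap
  nlinarith

theorem gap_le_one (x : CBall) : gap x ≤ 1 := by
  unfold gap
  nlinarith [sq_nonneg ‖(x : EuclideanSpace ℝ (Fin 3))‖]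

theorem mem_H3_iff {x : CBall} : x ∈ H3 ↔ 0 < gap x := by
  change ‖(x : EuclideanSpace ℝ (Fin 3))‖ < 1 ↔ 0 < 1 - ‖(x : EuclideanSpace ℝ (Fin 3))‖ ^ 2
  have := norm_nonneg (x : EuclideanSpace ℝ (Fin 3))
  constructor <;> intro h <;> nlinarith

theorem mem_sphereInf_iff {x : CBall} : x ∈ sphereInf ↔ gap x = 0 := by
  change ‖(x : EuclideanSpace ℝ (Fin 3))‖ = 1 ↔ 1 - ‖(x : EuclideanSpace ℝ (Fin 3))‖ ^ 2 = 0
  have := norm_nonneg (x : EuclideanSpace ℝ (Fin 3))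
  constructor
  · intro h; rw [h]; norm_num
  · intro h; nlinarith

theorem mem_sphereInf_iff_notMem_H3 {x : CBall} : x ∈ sphereInf ↔ x ∉ H3 := by
  rw [mem_sphereInf_iff, mem_H3_iff, not_lt]
  exact ⟨fun h => h.le, fun h => le_antisymm h (gap_nonneg x)⟩

theorem continuous_gap : Continuous gap := by
  unfold gap
  fun_prop

theorem origin_mem_H3 : origin ∈ H3 := by
  change ‖(0 : EuclideanSpace ℝ (Fin 3))‖ < 1
  simp

theorem gap_origin : gap origin = 1 := by
  simp [gap, origin]

theorem dist_origin (x : CBall) : dist x origin = ‖(x : EuclideanSpace ℝ (Fin 3))‖ := by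
  rw [Subtype.dist_eq]
  simp [origin]

theorem dist_origin_sq (x : CBall) : dist x origin ^ 2 = 1 - gap x := by
  rw [dist_origin, gap]
  ring

theorem dist_sq_eq {x y : CBall} (hx : x ∈ H3) (hy : y ∈ H3) :
    dist x y ^ 2 = Real.sinh (hdist x y / 2) ^ 2 * (gap x * gap y) := by
  rw [mem_H3_iff] at hx hy
  have hpos : 0 < gap x * gap y := mul_pos hx hy
  have : hdist x y / 2 = Real.arsinh (dist x y / Real.sqrt (gap x * gap y)) := by
    simp only [hdist, gap]
    ring
  rw [this, Real.sinh_arsinh, div_pow, Real.sq_sqrt hpos.le]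
  field_simp

/-- Radial contraction of the closed ball. -/
noncomputable def shrink (t : unitInterval) (x : CBall) : CBall :=
  ⟨(t : ℝ) • (x : EuclideanSpace ℝ (Fin 3)), by
    rw [mem_closedBall_zero_iff, norm_smul, Real.norm_of_nonneg t.2.1]
    exact mul_le_one₀ t.2.2 (norm_nonneg _) (norm_coe_le x)⟩

theorem continuous_shrink : Continuous fun p : unitInterval × CBall => shrink p.1 p.2 := by
  unfold shrink
  fun_prop

theorem shrink_mem_H3 {t : unitInterval} (ht : (t : ℝ) < 1) (x : CBall) : shrink t x ∈ H3 := by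
  change ‖(t : ℝ) • (x : EuclideanSpace ℝ (Fin 3))‖ < 1
  rw [norm_smul, Real.norm_of_nonneg t.2.1]
  calc (t : ℝ) * _ ≤ t * 1 := by
        have := t.2.1
        gcongr
        exact norm_coe_le x
    _ < 1 := by linarith

theorem dist_shrink_le (t : unitInterval) (x : CBall) : dist (shrink t x) x ≤ 1 - t := by
  rw [Subtype.dist_eq, dist_eq_norm, shrink]
  have : (t : ℝ) • (x : EuclideanSpace ℝ (Fin 3)) - x
      = -((1 - (t : ℝ)) • (x : EuclideanSpace ℝ (Fin 3))) := by
    rw [sub_smul, one_smul, neg_sub]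
  rw [this, norm_neg, norm_smul, Real.norm_of_nonneg (by linarith [t.2.2])]
  exact mul_le_of_le_one_right (by linarith [t.2.2]) (norm_coe_le x)

theorem dense_H3 : Dense H3 := by
  intro x
  rw [Metric.mem_closure_iff]
  intro ε hε
  have h1 : max (1 - ε / 2) 0 ∈ Icc (0 : ℝ) 1 := ⟨le_max_right _ _, max_le (by linarith) (by simp)⟩
  refine ⟨shrink ⟨_, h1⟩ x, shrink_mem_H3 (max_lt (by linarith) (by simp)) x, ?_⟩
  rw [dist_comm]
  refine (dist_shrink_le _ _).trans_lt ?_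
  have := le_max_left (1 - ε / 2) 0
  simp only
  linarith

/-! ### Conformal distortion of isometries, up to the sphere at infinity -/

theorem continuous_smul_iso (g : IsoH3) : Continuous fun x : CBall => g • x :=
  (g : CBall ≃ₜ CBall).continuous

theorem smul_mem_H3_iff (g : IsoH3) (x : CBall) : g • x ∈ H3 ↔ x ∈ H3 := g.2.1 x

theorem hdist_smul (g : IsoH3) {x y : CBall} (hx : x ∈ H3) (hy : y ∈ H3) :
    hdist (g • x) (g • y) = hdist x y := g.2.2 x hx y hy

/-- The conformal factor of an isometry for the Euclidean metric of the closed ball. -/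
noncomputable def jac (g : IsoH3) (x : CBall) : ℝ :=
  gap (g⁻¹ • origin) / (gap x * gap (g⁻¹ • origin) + dist x (g⁻¹ • origin) ^ 2)

theorem inv_smul_origin_mem (g : IsoH3) : g⁻¹ • origin ∈ H3 :=
  (smul_mem_H3_iff _ _).2 origin_mem_H3

theorem jac_denom_pos (g : IsoH3) (x : CBall) :
    0 < gap x * gap (g⁻¹ • origin) + dist x (g⁻¹ • origin) ^ 2 := by
  have hq := inv_smul_origin_mem g
  by_cases hx : x ∈ H3
  · have := mem_H3_iff.1 hx
    have := mem_H3_iff.1 hq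
    positivity
  · have h0 := gap_nonneg x
    have h1 := gap_nonneg (g⁻¹ • origin)
    have : x ≠ g⁻¹ • origin := fun h => hx (h ▸ hq)
    have := dist_pos.2 this
    positivity

theorem jac_pos (g : IsoH3) (x : CBall) : 0 < jac g x :=
  div_pos (mem_H3_iff.1 (inv_smul_origin_mem g)) (jac_denom_pos g x)

theorem continuous_jac (g : IsoH3) : Continuous (jac g) := by
  unfold jac
  exact continuous_const.div (by have := continuous_gap; fun_prop) fun x => (jac_denom_pos g x).ne'

/-- Inside the ball this is `hdist (g • x) origin = hdist x (g⁻¹ • origin)` rewritten through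
`dist_sq_eq`; both sides are continuous and `H3` is dense. -/
theorem gap_smul (g : IsoH3) (x : CBall) : gap (g • x) = gap x * jac g x := by
  revert x
  refine fun x => congrFun (Continuous.ext_on dense_H3 (continuous_gap.comp (continuous_smul_iso g))
    (continuous_gap.mul (continuous_jac g)) ?_) x
  intro x hx
  have hq := inv_smul_origin_mem g
  have hgx := (smul_mem_H3_iff g x).2 hx
  have h1 := dist_sq_eq hgx origin_mem_H3
  have h2 := dist_sq_eq hx hq
  have h3 : hdist (g • x) origin = hdist x (g⁻¹ • origin) := by
    have := hdist_smul g hx hq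
    rwa [smul_inv_smul] at this
  rw [dist_origin_sq, gap_origin, mul_one, h3] at h1
  have hd := jac_denom_pos g x
  change gap (g • x) = gap x * jac g x
  unfold jac
  rw [← mul_div_assoc, eq_div_iff hd.ne', h2]
  linear_combination (-(gap x * gap (g⁻¹ • origin))) * h1

/-- The Möbius distortion rule, obtained from invariance of `hdist` and `gap_smul` without explicit
formulas for isometries. Density in each variable extends it to the sphere. -/
theorem dist_smul_sq (g : IsoH3) (x y : CBall) :
    dist (g • x) (g • y) ^ 2 = jac g x * jac g y * dist x y ^ 2 := by
  have hc := continuous_smul_iso g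
  have hj := continuous_jac g
  have h1 : ∀ x ∈ H3, ∀ y ∈ H3,
      dist (g • x) (g • y) ^ 2 = jac g x * jac g y * dist x y ^ 2 := by
    intro x hx y hy
    rw [dist_sq_eq hx hy, dist_sq_eq ((smul_mem_H3_iff g x).2 hx) ((smul_mem_H3_iff g y).2 hy),
      hdist_smul g hx hy, gap_smul, gap_smul]
    ring
  have h2 : ∀ x ∈ H3, ∀ y, dist (g • x) (g • y) ^ 2 = jac g x * jac g y * dist x y ^ 2 := by
    intro x hx y
    exact congrFun (Continuous.ext_on dense_H3
      (f := fun y => dist (g • x) (g • y) ^ 2)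
      (g := fun y => jac g x * jac g y * dist x y ^ 2)
      (by fun_prop) (by fun_prop) (fun y hy => h1 x hx y hy)) y
  exact congrFun (Continuous.ext_on dense_H3
      (f := fun x => dist (g • x) (g • y) ^ 2)
      (g := fun x => jac g x * jac g y * dist x y ^ 2)
      (by fun_prop) (by fun_prop) (fun x hx => h2 x hx y)) x

theorem jac_mul (g h : IsoH3) (a : CBall) : jac (g * h) a = jac g (h • a) * jac h a := by
  have key : ∀ a ∈ H3, jac (g * h) a = jac g (h • a) * jac h a := by
    intro a ha
    have h1 := gap_smul (g * h) a
    rw [mul_smul, gap_smul g, gap_smul h, mul_assoc] at h1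
    rw [← mul_left_cancel₀ (mem_H3_iff.1 ha).ne' h1, mul_comm]
  exact congrFun (Continuous.ext_on dense_H3 (continuous_jac _)
    (((continuous_jac g).comp (continuous_smul_iso h)).mul (continuous_jac h)) key) a

theorem jac_one (a : CBall) : jac 1 a = 1 := by
  have h := jac_mul 1 1 a
  rw [mul_one, one_smul] at h
  have := (jac_pos 1 a).ne'
  field_simp at h
  exact h.symm

theorem jac_pow_of_fixed {g : IsoH3} {a : CBall} (h : g • a = a) (n : ℕ) :
    jac (g ^ n) a = jac g a ^ n := by
  induction n with
  | zero => simp [jac_one]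
  | succ n ih => rw [pow_succ, jac_mul, h, ih, pow_succ]

theorem pow_smul_of_fixed {g : IsoH3} {a : CBall} (h : g • a = a) (n : ℕ) : g ^ n • a = a := by
  induction n with
  | zero => simp
  | succ n ih => rw [pow_succ, mul_smul, h, ih]

/-! ## Discrete groups -/

section Discrete

variable {Γ : Subgroup IsoH3}

theorem finite_setOf_le_gap (hΓ : IsDiscreteGroup Γ) {δ : ℝ} (hδ : 0 < δ) :
    {g : IsoH3 | g ∈ Γ ∧ δ ≤ gap (g • origin)}.Finite := by
  refine (hΓ origin origin_mem_H3 (2 * Real.arsinh (1 / Real.sqrt δ))).subset ?_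
  rintro g ⟨hg, hle⟩
  refine ⟨hg, ?_⟩
  unfold hdist
  have h1 : (1 - ‖(origin : EuclideanSpace ℝ (Fin 3))‖ ^ 2) *
      (1 - ‖((g • origin : CBall) : EuclideanSpace ℝ (Fin 3))‖ ^ 2) = gap (g • origin) := by
    change gap origin * gap _ = _
    rw [gap_origin, one_mul]
  rw [h1]
  have h2 : dist origin (g • origin) ≤ 1 := by
    rw [dist_comm, dist_origin]
    exact norm_coe_le _
  have h3 : Real.sqrt δ ≤ Real.sqrt (gap (g • origin)) := Real.sqrt_le_sqrt hle
  have h4 : 0 < Real.sqrt δ := Real.sqrt_pos.2 hδ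
  gcongr

theorem finite_setOf_le_gap_inv (hΓ : IsDiscreteGroup Γ) {δ : ℝ} (hδ : 0 < δ) :
    {g : IsoH3 | g ∈ Γ ∧ δ ≤ gap (g⁻¹ • origin)}.Finite := by
  refine ((finite_setOf_le_gap hΓ hδ).preimage inv_injective.injOn).subset ?_
  rintro g ⟨hg, hle⟩
  exact ⟨Γ.inv_mem hg, hle⟩

theorem exists_finite_setOf_dist_lt (hΓ : IsDiscreteGroup Γ) {y : CBall} (hy : y ∉ limitSet Γ) :
    ∃ r > 0, {g : IsoH3 | g ∈ Γ ∧ dist (g • origin) y < r}.Finite := by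
  by_cases hyH : y ∈ H3
  · have h1 : ∀ᶠ x in 𝓝 y, gap y / 2 < gap x :=
      continuous_gap.continuousAt.eventually_const_lt (half_lt_self (mem_H3_iff.1 hyH))
    obtain ⟨r, hr, h⟩ := Metric.eventually_nhds_iff.1 h1
    refine ⟨r, hr, (finite_setOf_le_gap hΓ (half_pos (mem_H3_iff.1 hyH))).subset ?_⟩
    rintro g ⟨hg, hd⟩
    exact ⟨hg, (h hd).le⟩
  · have h1 : y ∉ closure {x | ∃ g ∈ Γ, x = g • origin} := fun h =>
      hy ⟨mem_sphereInf_iff_notMem_H3.2 hyH, h⟩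
    rw [Metric.mem_closure_iff] at h1
    push Not at h1
    obtain ⟨r, hr, h⟩ := h1
    refine ⟨r, hr, Set.finite_empty.subset ?_⟩
    rintro g ⟨hg, hd⟩
    have := h _ ⟨g, hg, rfl⟩
    rw [dist_comm] at this
    exact absurd hd (not_lt.2 this)

/-- The action on the complement of the limit set is properly discontinuous. -/
theorem exists_nhds_finite (hΓ : IsDiscreteGroup Γ) {x y : CBall} (hx : x ∉ limitSet Γ)
    (hy : y ∉ limitSet Γ) :
    ∃ U ∈ 𝓝 x, ∃ V ∈ 𝓝 y, {g : IsoH3 | g ∈ Γ ∧ ∃ z ∈ U, g • z ∈ V}.Finite := by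
  obtain ⟨r, hr, hfr⟩ := exists_finite_setOf_dist_lt hΓ hy
  obtain ⟨s, hs, hfs⟩ := exists_finite_setOf_dist_lt hΓ hx
  have hfs' : {g : IsoH3 | g ∈ Γ ∧ dist (g⁻¹ • origin) x < s}.Finite := by
    refine (hfs.preimage inv_injective.injOn).subset ?_
    rintro g ⟨hg, hd⟩
    exact ⟨Γ.inv_mem hg, hd⟩
  refine ⟨Metric.ball x (s / 2), Metric.ball_mem_nhds _ (half_pos hs),
    Metric.ball y (r / 2), Metric.ball_mem_nhds _ (half_pos hr), ?_⟩
  -- If `g • origin` stays away from `y` and `g⁻¹ • origin` from `x`, the distortion rule at `(z,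
  -- origin)` gives `(r / 2) ^ 2 ≤ gap (g⁻¹ • origin) / (s / 2) ^ 2`, which leaves finitely many
  -- `g`.
  refine ((hfr.union hfs').union
    (finite_setOf_le_gap_inv hΓ (δ := r ^ 2 * s ^ 2 / 16) (by positivity))).subset ?_
  rintro g ⟨hg, z, hz, hgz⟩
  by_contra hcon
  simp only [mem_union, mem_ofPred_eq, not_or, not_and, not_lt, not_le] at hcon
  obtain ⟨⟨h1, h2⟩, h3⟩ := hcon
  replace h1 := h1 hg
  replace h2 := h2 hg
  replace h3 := h3 hg
  simp only [Metric.mem_ball] at hz hgz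
  set q := g⁻¹ • origin with hq
  have hzq : s / 2 ≤ dist z q := by
    have := dist_triangle q z x
    rw [dist_comm q z] at this
    linarith
  have hgz0 : r / 2 ≤ dist (g • z) (g • origin) := by
    have := dist_triangle (g • origin) (g • z) y
    rw [dist_comm (g • origin) (g • z)] at this
    linarith
  have hq0 := gap_nonneg q
  have hjz : jac g z ≤ gap q / (s / 2) ^ 2 := by
    unfold jac
    rw [← hq]
    apply div_le_div_of_nonneg_left hq0 (by positivity)
    have := gap_nonneg z
    nlinarith [mul_nonneg this hq0]
  have hj0 : jac g origin = gap q := by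
    unfold jac
    rw [← hq, gap_origin, dist_comm, dist_origin_sq]
    simp
  have hd := dist_smul_sq g z origin
  have hz1 : dist z origin ^ 2 ≤ 1 := by
    rw [dist_origin_sq]
    linarith [gap_nonneg z]
  have hle : (r / 2) ^ 2 ≤ gap q / (s / 2) ^ 2 * 1 * 1 := by
    calc (r / 2) ^ 2 ≤ dist (g • z) (g • origin) ^ 2 := by gcongr
      _ = jac g z * jac g origin * dist z origin ^ 2 := hd
      _ ≤ gap q / (s / 2) ^ 2 * 1 * 1 := by
        rw [hj0]
        have := gap_le_one q
        have := jac_pos g z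
        gcongr
  rw [mul_one, mul_one, le_div_iff₀ (by positivity)] at hle
  linarith

theorem eq_one_of_forall_pow_mem (htf : IsTorsionFreeGroup Γ) {g : IsoH3} (hg : g ∈ Γ)
    {S : Set IsoH3} (hS : S.Finite) (h : ∀ n : ℕ, g ^ n ∈ S) : g = 1 := by
  have hni : ¬ Function.Injective fun n : ℕ => g ^ n := fun hinj =>
    Set.infinite_range_of_injective hinj (hS.subset (range_subset_iff.2 h))
  have key : ∀ m k : ℕ, m < k → g ^ m = g ^ k → g = 1 := by
    intro m k hlt e
    refine htf g hg (k - m) (by omega) ?_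
    have : g ^ m * g ^ (k - m) = g ^ m * 1 := by
      rw [← pow_add, Nat.add_sub_cancel' hlt.le, mul_one, e]
    exact mul_left_cancel this
  simp only [Function.Injective, not_forall] at hni
  obtain ⟨m, k, e, hne⟩ := hni
  obtain h | h := lt_or_gt_of_ne hne
  · exact key m k h e
  · exact key k m h e.symm

/-- The action on the complement of the limit set is free. -/
theorem eq_one_of_smul_eq (hΓ : IsDiscreteGroup Γ) (htf : IsTorsionFreeGroup Γ) {g : IsoH3}
    (hg : g ∈ Γ) {x : CBall} (hx : x ∉ limitSet Γ) (h : g • x = x) : g = 1 := by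
  obtain ⟨U, hU, V, hV, hfin⟩ := exists_nhds_finite hΓ hx hx
  refine eq_one_of_forall_pow_mem htf hg hfin fun n => ⟨Γ.pow_mem hg n, x, mem_of_mem_nhds hU, ?_⟩
  rw [pow_smul_of_fixed h]
  exact mem_of_mem_nhds hV

/-- For `a` on the sphere, `dist x a ^ 2 = gap x` is the horosphere at `a` through the origin; two
such horospheres with distinct centres meet in a bounded part of `H3`. -/
theorem gap_ge_of_dist_sq_eq {a b x : CBall} (ha : dist x a ^ 2 = gap x)
    (hb : dist x b ^ 2 = gap x) : dist a b ^ 2 / 4 ≤ gap x := by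
  have h1 := dist_triangle_left a b x
  have h2 : dist a b ^ 2 ≤ (dist x a + dist x b) ^ 2 := by
    have := dist_nonneg (x := a) (y := b)
    gcongr
  nlinarith [sq_nonneg (dist x a - dist x b)]

theorem dist_origin_sphere {a : CBall} (ha : a ∈ sphereInf) : dist origin a ^ 2 = 1 := by
  rw [dist_comm, dist_origin_sq, mem_sphereInf_iff.1 ha, sub_zero]

theorem dist_pow_smul_origin_sq {g : IsoH3} {a : CBall} (ha : a ∈ sphereInf) (h : g • a = a)
    (n : ℕ) : dist (g ^ n • origin) a ^ 2 = jac g a ^ n * gap (g ^ n • origin) := by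
  have := dist_smul_sq (g ^ n) origin a
  rw [pow_smul_of_fixed h, dist_origin_sphere ha, jac_pow_of_fixed h, mul_one] at this
  rw [this, gap_smul, gap_origin, one_mul, mul_comm]

theorem jac_mul_jac_eq_one {g : IsoH3} {a b : CBall} (hab : a ≠ b)
    (h : dist (g • a) (g • b) = dist a b) : jac g a * jac g b = 1 := by
  have h1 := dist_smul_sq g a b
  rw [h] at h1
  have : dist a b ^ 2 ≠ 0 := (pow_pos (dist_pos.2 hab) 2).ne'
  exact mul_right_cancel₀ this (by rw [← h1, one_mul])

/-- With multiplier `1` at both fixed points, all powers keep the origin on the two horospheres, so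
they form a finite set and `g` is torsion. -/
theorem eq_one_of_fixed_of_jac_eq_one (hΓ : IsDiscreteGroup Γ) (htf : IsTorsionFreeGroup Γ)
    {a b : CBall} (ha : a ∈ sphereInf) (hb : b ∈ sphereInf) (hab : a ≠ b) {g : IsoH3} (hg : g ∈ Γ)
    (hga : g • a = a) (hgb : g • b = b) (hj : jac g a = 1) : g = 1 := by
  have hjb : jac g b = 1 := by
    have := jac_mul_jac_eq_one (g := g) hab (by rw [hga, hgb])
    rwa [hj, one_mul] at this
  have hpos := dist_pos.2 hab
  refine eq_one_of_forall_pow_mem htf hg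
    (finite_setOf_le_gap hΓ (δ := dist a b ^ 2 / 4) (by positivity))
    fun n => ⟨Γ.pow_mem hg n, ?_⟩
  apply gap_ge_of_dist_sq_eq
  · rw [dist_pow_smul_origin_sq ha hga, hj, one_pow, one_mul]
  · rw [dist_pow_smul_origin_sq hb hgb, hjb, one_pow, one_mul]

/-- A torsion-free discrete group preserving a pair of points at infinity is abelian. -/
theorem commute_of_preserves_pair (hΓ : IsDiscreteGroup Γ) (htf : IsTorsionFreeGroup Γ)
    {a b : CBall} (ha : a ∈ sphereInf) (hb : b ∈ sphereInf) (hab : a ≠ b)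
    (h : ∀ g ∈ Γ, (g • a = a ∧ g • b = b) ∨ (g • a = b ∧ g • b = a)) :
    ∀ g ∈ Γ, ∀ k ∈ Γ, g * k = k * g := by
  have hfix : ∀ g ∈ Γ, g • a = a ∧ g • b = b := by
    intro g hg
    refine (h g hg).resolve_right ?_
    -- If `g` swaps the points, `g * g` fixes both with multiplier `jac g b * jac g a = 1`.
    rintro ⟨h1, h2⟩
    have hj := jac_mul_jac_eq_one (g := g) hab (by rw [h1, h2, dist_comm])
    have hgg : g * g = 1 := eq_one_of_fixed_of_jac_eq_one hΓ htf ha hb hab (Γ.mul_mem hg hg)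
      (by rw [mul_smul, h1, h2]) (by rw [mul_smul, h2, h1]) (by rw [jac_mul, h1, mul_comm, hj])
    have hg1 : g = 1 := htf g hg 2 two_ne_zero (by rw [pow_two, hgg])
    rw [hg1, one_smul] at h1
    exact hab h1
  intro g hg k hk
  have hgk := Γ.mul_mem hg hk
  have hkg := Γ.mul_mem hk hg
  have hm := Γ.mul_mem hgk (Γ.inv_mem hkg)
  -- Multipliers at a common fixed point multiply commutatively, so a commutator has multiplier `1`.
  have he : g * k * (k * g)⁻¹ = 1 := by
    refine eq_one_of_fixed_of_jac_eq_one hΓ htf ha hb hab hm (hfix _ hm).1 (hfix _ hm).2 ?_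
    have h1 := jac_mul (g * k * (k * g)⁻¹) (k * g) a
    rw [inv_mul_cancel_right, (hfix _ hkg).1, jac_mul g k, jac_mul k g, (hfix _ hg).1,
      (hfix _ hk).1] at h1
    have h2 := (jac_pos g a).ne'
    have h3 := (jac_pos k a).ne'
    exact mul_right_cancel₀ (mul_ne_zero h3 h2) (by rw [← h1, one_mul, mul_comm])
  exact mul_inv_eq_one.1 he

/-- A non-abelian torsion-free discrete group has a limit point other than two given ones. -/
theorem exists_mem_limitSet_ne (hΓ : IsDiscreteGroup Γ) (htf : IsTorsionFreeGroup Γ)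
    (hna : ¬ ∀ g ∈ Γ, ∀ h ∈ Γ, g * h = h * g) {a b : CBall} (ha : a ∈ limitSet Γ)
    (hb : b ∈ limitSet Γ) (hab : a ≠ b) : ∃ p ∈ limitSet Γ, p ≠ a ∧ p ≠ b := by
  by_contra hcon
  push Not at hcon
  refine hna (commute_of_preserves_pair hΓ htf ha.1 hb.1 hab fun g hg => ?_)
  have h1 := hcon _ (smul_mem_limitSet hg ha)
  have h2 := hcon _ (smul_mem_limitSet hg hb)
  have h3 : g • a ≠ g • b := fun h => hab ((MulAction.injective g) h)
  by_cases e : g • a = a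
  · left
    refine ⟨e, h2 fun e' => h3 (e.trans e'.symm)⟩
  · right
    have e2 := h1 e
    refine ⟨e2, ?_⟩
    by_contra e3
    exact h3 (e2.trans (h2 e3).symm)

end Discrete

/-! ## Lifts to the complement of the limit set -/

theorem exists_smul_of_proj_eq {Γ : Subgroup IsoH3} {x y : bordification Γ}
    (h : proj Γ x = proj Γ y) : ∃ g ∈ Γ, (x : CBall) = g • (y : CBall) := by
  obtain ⟨g, hg⟩ := MulAction.orbitRel_apply.1 (Quotient.exact h)
  exact ⟨g, g.2, (congrArg Subtype.val hg).symm⟩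

/-- Two lifts of the same curve differ by an element of the group. -/
theorem exists_smul_eq_of_forall {Γ : Subgroup IsoH3} (hΓ : IsDiscreteGroup Γ)
    (htf : IsTorsionFreeGroup Γ) {X : Type*} [TopologicalSpace X] [ConnectedSpace X]
    {u v : X → CBall} (hu : Continuous u) (hv : Continuous v) (hul : ∀ x, u x ∉ limitSet Γ)
    (hvl : ∀ x, v x ∉ limitSet Γ) (h : ∀ x, ∃ g ∈ Γ, u x = g • v x) :
    ∃ g ∈ Γ, ∀ x, u x = g • v x := by
  obtain ⟨x₀⟩ : Nonempty X := inferInstance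
  obtain ⟨g, hg, hx₀⟩ := h x₀
  refine ⟨g, hg, fun x => ?_⟩
  have hcl : IsClosed {x | u x = g • v x} := isClosed_eq hu ((continuous_smul_iso g).comp hv)
  -- Near `x` proper discontinuity leaves finitely many candidates `k`; freeness excludes each `k ≠
  -- g` at `x`, hence nearby.
  have hop : IsOpen {x | u x = g • v x} := by
    rw [isOpen_iff_mem_nhds]
    intro x hx
    obtain ⟨U, hU, V, hV, hfin⟩ := exists_nhds_finite hΓ (hvl x) (hul x)
    have hev : ∀ᶠ y in 𝓝 x, ∀ k ∈ {k : IsoH3 | k ∈ Γ ∧ ∃ z ∈ U, k • z ∈ V},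
        k ≠ g → u y ≠ k • v y := by
      rw [Filter.eventually_all_finite hfin]
      rintro k ⟨hk, -⟩
      by_cases hkg : k = g
      · exact Eventually.of_forall fun y h => absurd hkg h
      have hne : u x ≠ k • v x := by
        intro e
        refine hkg (mul_inv_eq_one.1 ?_ : k = g)
        refine eq_one_of_smul_eq hΓ htf (Γ.mul_mem hk (Γ.inv_mem hg)) (hul x) ?_
        rw [mul_smul]
        nth_rw 1 [show u x = g • v x from hx]
        rw [inv_smul_smul, ← e]
      filter_upwards [(isClosed_eq hu
        ((continuous_smul_iso k).comp hv)).isOpen_compl.mem_nhds hne] with y hy _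
      exact hy
    filter_upwards [hev, hv.continuousAt hU, hu.continuousAt hV] with y h1 h2 h3
    obtain ⟨k, hk, hky⟩ := h y
    by_cases hkg : k = g
    · rwa [← hkg]
    · exact absurd hky (h1 k ⟨hk, v y, h2, by rw [← hky]; exact h3⟩ hkg)
  have hx : x ∈ {x | u x = g • v x} := by
    rw [IsClopen.eq_univ ⟨hcl, hop⟩ ⟨x₀, hx₀⟩]
    trivial
  exact hx

/-! ## Geodesic lines -/

/-- A unit speed parametrization of a geodesic line. -/
def IsUnitSpeed (c : ℝ → CBall) : Prop :=
  (∀ t, c t ∈ H3) ∧ ∀ s t, hdist (c s) (c t) = |s - t|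

namespace IsUnitSpeed

variable {c : ℝ → CBall}

theorem comp_neg (hc : IsUnitSpeed c) : IsUnitSpeed fun t => c (-t) :=
  ⟨fun t => hc.1 _, fun s t => by rw [hc.2, ← abs_neg]; ring_nf⟩

theorem smul (hc : IsUnitSpeed c) (g : IsoH3) : IsUnitSpeed fun t => g • c t :=
  ⟨fun t => (smul_mem_H3_iff g _).2 (hc.1 t), fun s t => by
    rw [hdist_smul g (hc.1 s) (hc.1 t), hc.2]⟩

theorem gap_pos (hc : IsUnitSpeed c) (t : ℝ) : 0 < gap (c t) := mem_H3_iff.1 (hc.1 t)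

theorem dist_sq (hc : IsUnitSpeed c) (s t : ℝ) :
    dist (c s) (c t) ^ 2 = Real.sinh ((s - t) / 2) ^ 2 * (gap (c s) * gap (c t)) := by
  rw [dist_sq_eq (hc.1 s) (hc.1 t), hc.2]
  congr 1
  obtain h | h := abs_choice (s - t)
  · rw [h]
  · rw [h, neg_div, Real.sinh_neg, neg_sq]

theorem continuous (hc : IsUnitSpeed c) : Continuous c := by
  rw [continuous_iff_continuousAt]
  intro t
  rw [ContinuousAt, tendsto_iff_dist_tendsto_zero]
  have h1 : Tendsto (fun s => |Real.sinh ((s - t) / 2)|) (𝓝 t) (𝓝 0) := by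
    have : Continuous fun s => |Real.sinh ((s - t) / 2)| :=
      (Real.continuous_sinh.comp (by fun_prop)).abs
    have h := this.tendsto t
    simpa using h
  refine squeeze_zero (fun _ => dist_nonneg) (fun s => ?_) h1
  refine abs_le_of_sq_le_sq' ?_ (abs_nonneg _) |>.2
  rw [hc.dist_sq, sq_abs]
  have h2 := gap_le_one (c s)
  have h3 := gap_le_one (c t)
  have h4 := gap_nonneg (c s)
  have h5 := gap_nonneg (c t)
  exact mul_le_of_le_one_right (sq_nonneg _) (mul_le_one₀ h2 h5 h3)

theorem dist_zero_sq (hc : IsUnitSpeed c) (t : ℝ) :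
    dist (c 0) (c t) ^ 2 / gap (c 0) = Real.sinh (t / 2) ^ 2 * gap (c t) := by
  rw [hc.dist_sq, zero_sub, neg_div, Real.sinh_neg, neg_sq, div_eq_iff (hc.gap_pos 0).ne']
  ring

/-- Euclidean distances are at most `2`, so `sinh² (t / 2) * gap (c t)` stays bounded. -/
theorem tendsto_gap (hc : IsUnitSpeed c) : Tendsto (fun t => gap (c t)) atTop (𝓝 0) := by
  have h0 := hc.gap_pos 0
  have hlim : Tendsto (fun t : ℝ => 4 / gap (c 0) / (t / 2) ^ 2) atTop (𝓝 0) := by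
    refine tendsto_const_nhds.div_atTop ?_
    exact (tendsto_pow_atTop two_ne_zero).comp (tendsto_id.atTop_div_const two_pos)
  refine squeeze_zero' (Eventually.of_forall fun t => (hc.gap_pos t).le) ?_ hlim
  filter_upwards [eventually_gt_atTop 0] with t ht
  have hs : t / 2 ≤ Real.sinh (t / 2) := Real.self_le_sinh_iff.2 (by positivity)
  have hd : dist (c 0) (c t) ≤ 2 := by
    have := dist_triangle_right (c 0) (c t) origin
    rw [dist_origin, dist_origin] at this
    linarith [norm_coe_le (c 0), norm_coe_le (c t)]
  rw [le_div_iff₀ (by positivity)]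
  calc gap (c t) * (t / 2) ^ 2 ≤ gap (c t) * Real.sinh (t / 2) ^ 2 := by
        have := (hc.gap_pos t).le
        gcongr
    _ = dist (c 0) (c t) ^ 2 / gap (c 0) := by rw [hc.dist_zero_sq, mul_comm]
    _ ≤ 2 ^ 2 / gap (c 0) := by gcongr
    _ = 4 / gap (c 0) := by norm_num

theorem exists_tendsto (hc : IsUnitSpeed c) : ∃ b ∈ sphereInf, Tendsto c atTop (𝓝 b) := by
  have h0 := hc.gap_pos 0
  have hcs : CauchySeq c := by
    rw [Metric.cauchySeq_iff']
    intro ε hε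
    have h1 : Tendsto (fun t => 4 / gap (c 0) * gap (c t)) atTop (𝓝 0) := by
      simpa using hc.tendsto_gap.const_mul (4 / gap (c 0))
    obtain ⟨N, hN, hN0⟩ := ((h1.eventually_lt_const (show (0 : ℝ) < ε ^ 2 by positivity)).and
      (eventually_ge_atTop 0)).exists
    refine ⟨N, fun n hn => ?_⟩
    refine lt_of_pow_lt_pow_left₀ 2 hε.le (lt_of_le_of_lt ?_ hN)
    have hd : dist (c 0) (c n) ≤ 2 := by
      have := dist_triangle_right (c 0) (c n) origin
      rw [dist_origin, dist_origin] at this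
      linarith [norm_coe_le (c 0), norm_coe_le (c n)]
    have hs0 : 0 ≤ Real.sinh ((n - N) / 2) := Real.sinh_nonneg_iff.2 (by linarith)
    have hs : Real.sinh ((n - N) / 2) ≤ Real.sinh (n / 2) := Real.sinh_le_sinh.2 (by linarith)
    have h5 := gap_nonneg (c n)
    have h6 := gap_nonneg (c N)
    calc dist (c n) (c N) ^ 2 = Real.sinh ((n - N) / 2) ^ 2 * gap (c n) * gap (c N) := by
          rw [hc.dist_sq, mul_assoc]
      _ ≤ Real.sinh (n / 2) ^ 2 * gap (c n) * gap (c N) := by gcongr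
      _ = dist (c 0) (c n) ^ 2 / gap (c 0) * gap (c N) := by rw [hc.dist_zero_sq]
      _ ≤ 2 ^ 2 / gap (c 0) * gap (c N) := by gcongr
      _ = 4 / gap (c 0) * gap (c N) := by norm_num
  obtain ⟨b, hb⟩ := cauchySeq_tendsto_of_complete hcs
  refine ⟨b, ?_, hb⟩
  rw [mem_sphereInf_iff]
  exact tendsto_nhds_unique (continuous_gap.continuousAt.tendsto.comp hb) hc.tendsto_gap

theorem tendsto_sinh_sq_mul_gap (hc : IsUnitSpeed c) {b : CBall} (hb : Tendsto c atTop (𝓝 b)) :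
    Tendsto (fun t => Real.sinh (t / 2) ^ 2 * gap (c t)) atTop
      (𝓝 (dist (c 0) b ^ 2 / gap (c 0))) := by
  simp only [← hc.dist_zero_sq]
  exact ((tendsto_const_nhds.dist hb).pow 2).div_const _

theorem dist_sq_div_gap_pos (hc : IsUnitSpeed c) {b : CBall} (hb : b ∈ sphereInf) :
    0 < dist (c 0) b ^ 2 / gap (c 0) := by
  have h0 := hc.gap_pos 0
  have : c 0 ≠ b := fun h => mem_sphereInf_iff_notMem_H3.1 hb (h ▸ hc.1 0)
  have := dist_pos.2 this
  positivity

/-- `dist (c (-t)) (c t) ^ 2` is at least the product of the two quantities `sinh² (t / 2) * gap`,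
whose limits are positive. -/
theorem ends_ne (hc : IsUnitSpeed c) {a b : CBall} (ha' : a ∈ sphereInf) (hb' : b ∈ sphereInf)
    (ha : Tendsto (fun t => c (-t)) atTop (𝓝 a)) (hb : Tendsto c atTop (𝓝 b)) : a ≠ b := by
  have h1 := (hc.comp_neg.tendsto_sinh_sq_mul_gap ha).mul (hc.tendsto_sinh_sq_mul_gap hb)
  have hpos := mul_pos (hc.comp_neg.dist_sq_div_gap_pos ha') (hc.dist_sq_div_gap_pos hb')
  have h2 : Tendsto (fun t => dist (c (-t)) (c t) ^ 2) atTop (𝓝 (dist a b ^ 2)) :=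
    (ha.dist hb).pow 2
  have h3 := le_of_tendsto_of_tendsto h1 h2 (by
    filter_upwards [eventually_ge_atTop 0] with t ht
    rw [hc.dist_sq]
    have e : (-t - t) / 2 = -(2 * (t / 2)) := by ring
    rw [e, Real.sinh_neg, neg_sq, Real.sinh_two_mul]
    have hsc : Real.sinh (t / 2) ^ 2 ≤ (2 * Real.cosh (t / 2)) ^ 2 := by
      rw [mul_pow, Real.cosh_sq]
      nlinarith [sq_nonneg (Real.sinh (t / 2))]
    have h5 := gap_nonneg (c (-t))
    have h6 := gap_nonneg (c t)
    calc Real.sinh (t / 2) ^ 2 * gap (c (-t)) * (Real.sinh (t / 2) ^ 2 * gap (c t))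
        = Real.sinh (t / 2) ^ 2 * Real.sinh (t / 2) ^ 2 * (gap (c (-t)) * gap (c t)) := by ring
      _ ≤ Real.sinh (t / 2) ^ 2 * (2 * Real.cosh (t / 2)) ^ 2 * (gap (c (-t)) * gap (c t)) := by
        gcongr
      _ = _ := by ring)
  rintro rfl
  rw [dist_self] at h3
  norm_num at h3
  linarith

variable {g : IsoH3} {l : ℝ}

theorem fixes_end (hg : ∀ t, c (t + l) = g • c t) {b : CBall} (hb : Tendsto c atTop (𝓝 b)) :
    g • b = b := by
  have h1 : Tendsto (fun t => c (t + l)) atTop (𝓝 b) :=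
    hb.comp (tendsto_atTop_add_const_right _ _ tendsto_id)
  simp only [hg] at h1
  exact tendsto_nhds_unique ((continuous_smul_iso g).continuousAt.tendsto.comp hb) h1

theorem neg_translate (hg : ∀ t, c (t + l) = g • c t) (t : ℝ) : c (-(t + l)) = g⁻¹ • c (-t) := by
  rw [eq_inv_smul_iff, ← hg]
  congr 1
  ring

/-- The points `g ^ n • c 0 = c (n * l)` tend to `b`, and `g ^ n • origin` stays at constant
hyperbolic distance from them, so the Euclidean distance tends to `0`. -/
theorem end_mem_limitSet {Γ : Subgroup IsoH3} (hc : IsUnitSpeed c) (hl : 0 < l)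
    (hg : ∀ t, c (t + l) = g • c t) (hgΓ : g ∈ Γ) {b : CBall} (hbs : b ∈ sphereInf)
    (hb : Tendsto c atTop (𝓝 b)) : b ∈ limitSet Γ := by
  have hpow : ∀ n : ℕ, g ^ n • c 0 = c (n * l) := by
    intro n
    induction n with
    | zero => simp
    | succ n ih =>
      rw [pow_succ', mul_smul, ih, ← hg]
      congr 1
      push_cast
      ring
  have hnl : Tendsto (fun n : ℕ => (n : ℝ) * l) atTop atTop :=
    tendsto_natCast_atTop_atTop.atTop_mul_const hl
  have h1 : Tendsto (fun n : ℕ => c (n * l)) atTop (𝓝 b) := hb.comp hnl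
  have h2 : Tendsto (fun n : ℕ => gap (c (n * l))) atTop (𝓝 0) := hc.tendsto_gap.comp hnl
  have h3 : Tendsto (fun n : ℕ => g ^ n • origin) atTop (𝓝 b) := by
    refine h1.congr_dist ?_
    have h4 : Tendsto (fun n : ℕ =>
        Real.sqrt (Real.sinh (hdist (c 0) origin / 2) ^ 2 * gap (c (n * l)))) atTop (𝓝 0) := by
      have := (h2.const_mul (Real.sinh (hdist (c 0) origin / 2) ^ 2)).sqrt
      simpa using this
    refine squeeze_zero (fun _ => dist_nonneg) (fun n => ?_) h4
    refine Real.le_sqrt_of_sq_le ?_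
    rw [← hpow, dist_sq_eq ((smul_mem_H3_iff _ _).2 (hc.1 0))
      ((smul_mem_H3_iff _ _).2 origin_mem_H3), hdist_smul _ (hc.1 0) origin_mem_H3]
    have := gap_le_one (g ^ n • origin)
    have := gap_nonneg (g ^ n • c 0)
    gcongr
    exact mul_le_of_le_one_right this (gap_le_one _)
  exact ⟨hbs, mem_closure_of_tendsto h3 (Eventually.of_forall fun n =>
    ⟨g ^ n, Γ.pow_mem hgΓ n, rfl⟩)⟩

/-- The multiplier of a translation at the repelling end of its axis. -/
theorem jac_end (hc : IsUnitSpeed c) (hg : ∀ t, c (t + l) = g • c t) {a : CBall}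
    (has : a ∈ sphereInf) (ha : Tendsto (fun t => c (-t)) atTop (𝓝 a)) :
    jac g a = Real.exp l := by
  have hga : g⁻¹ • a = a := fixes_end (c := fun t => c (-t)) (l := l) (neg_translate hg) ha
  replace hga : g • a = a := by rw [← hga, smul_inv_smul, hga]
  have h1 : Tendsto (fun u => dist (c l) (c (-u)) ^ 2) atTop (𝓝 (dist (c l) a ^ 2)) :=
    (tendsto_const_nhds.dist ha).pow 2
  have hB := hc.comp_neg.tendsto_sinh_sq_mul_gap ha
  simp only [neg_zero] at hB
  have hgap := hc.comp_neg.tendsto_gap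
  have hexp : Tendsto (fun u : ℝ => Real.exp (-u)) atTop (𝓝 0) := Real.tendsto_exp_neg_atTop_nhds_zero
  -- Expansion of `sinh² ((l + u) / 2)` as `exp l * sinh² (u / 2)` plus a bounded term, which `gap
  -- (c (-u))` kills. Thus `dist (c t) a ^ 2 / gap (c t)` is multiplied by `exp l` from `t = 0` to
  -- `t = l`; the distortion rule says it is multiplied by `jac g a`.
  have h2 : Tendsto (fun u => (Real.exp l * (Real.sinh (u / 2) ^ 2 * gap (c (-u)))
      + (Real.exp (l / 2) * Real.sinh (l / 2) * (1 - Real.exp (-u))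
        + Real.sinh (l / 2) ^ 2 * Real.exp (-u)) * gap (c (-u))) * gap (c l)) atTop
      (𝓝 ((Real.exp l * (dist (c 0) a ^ 2 / gap (c 0))
        + (Real.exp (l / 2) * Real.sinh (l / 2) * (1 - 0) + Real.sinh (l / 2) ^ 2 * 0) * 0)
          * gap (c l))) :=
    ((hB.const_mul _).add ((((tendsto_const_nhds.sub hexp).const_mul _).add
      (hexp.const_mul _)).mul hgap)).mul_const _
  have h3 : ∀ u, dist (c l) (c (-u)) ^ 2 = (Real.exp l * (Real.sinh (u / 2) ^ 2 * gap (c (-u)))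
      + (Real.exp (l / 2) * Real.sinh (l / 2) * (1 - Real.exp (-u))
        + Real.sinh (l / 2) ^ 2 * Real.exp (-u)) * gap (c (-u))) * gap (c l) := by
    intro u
    rw [hc.dist_sq]
    have e1 : Real.sinh ((l - -u) / 2)
        = Real.exp (l / 2) * Real.sinh (u / 2) + Real.sinh (l / 2) * Real.exp (-(u / 2)) := by
      rw [show (l - -u) / 2 = l / 2 + u / 2 by ring, Real.sinh_add, ← Real.cosh_sub_sinh (u / 2),
        ← Real.cosh_add_sinh (l / 2)]
      ring
    have e2 : Real.exp l = Real.exp (l / 2) ^ 2 := by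
      rw [← Real.exp_nat_mul]
      congr 1
      push_cast
      ring
    have e3 : Real.exp (-u) = Real.exp (-(u / 2)) ^ 2 := by
      rw [← Real.exp_nat_mul]
      congr 1
      push_cast
      ring
    have e4 : Real.sinh (u / 2) * Real.exp (-(u / 2)) = (1 - Real.exp (-u)) / 2 := by
      rw [Real.sinh_eq, e3]
      have : Real.exp (u / 2) * Real.exp (-(u / 2)) = 1 := by rw [← Real.exp_add]; simp
      linear_combination this / 2
    rw [e1, e2]
    linear_combination (gap (c l) * gap (c (-u))) * (2 * Real.exp (l / 2) * Real.sinh (l / 2) * e4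
      - Real.sinh (l / 2) ^ 2 * e3)
  simp only [h3] at h1
  have h4 := tendsto_nhds_unique h1 h2
  have hcl : c l = g • c 0 := by rw [← hg, zero_add]
  have h5 := dist_smul_sq g (c 0) a
  rw [hga, ← hcl, h4, hcl, gap_smul] at h5
  have h0 := (hc.gap_pos 0).ne'
  have hj := (jac_pos g (c 0)).ne'
  have hd : dist (c 0) a ^ 2 ≠ 0 := by
    have := hc.dist_sq_div_gap_pos has
    intro h
    rw [h, zero_div] at this
    exact lt_irrefl _ this
  field_simp at h5
  exact mul_left_cancel₀ hd (by linarith)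

end IsUnitSpeed

/-! ## Stereographic projection with prescribed zero and pole -/

theorem exists_linearIsometry_orthogonal {b : EuclideanSpace ℝ (Fin 3)} (hb : b ≠ 0) :
    ∃ L : ℂ →ₗᵢ[ℝ] EuclideanSpace ℝ (Fin 3), (∀ w, inner ℝ b (L w) = 0) ∧
      ∀ y, inner ℝ b y = 0 → ∃ w, L w = y := by
  have : Fact (Module.finrank ℝ (EuclideanSpace ℝ (Fin 3)) = 2 + 1) := ⟨by simp⟩
  let e : ℂ ≃ₗᵢ[ℝ] (Submodule.span ℝ {b})ᗮ := Complex.orthonormalBasisOneI.repr.trans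
    (OrthonormalBasis.fromOrthogonalSpanSingleton (𝕜 := ℝ) 2 hb).repr.symm
  refine ⟨(Submodule.subtypeₗᵢ _).comp e.toLinearIsometry, fun w => ?_, fun y hy => ?_⟩
  · exact Submodule.mem_orthogonal_singleton_iff_inner_right.1 (e w).2
  · refine ⟨e.symm ⟨y, Submodule.mem_orthogonal_singleton_iff_inner_right.2 hy⟩, ?_⟩
    simp

/-- `S` is a conformal coordinate on the sphere with zero `a` and pole `b`, with inverse `τ`. -/
structure IsStereoChart (a b : CBall) (S : EuclideanSpace ℝ (Fin 3) → ℂ) (τ : ℂ → CBall) :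
    Prop where
  continuousAt : ∀ x : EuclideanSpace ℝ (Fin 3), x ≠ b → ContinuousAt S x
  continuous_inv : Continuous τ
  inv_mem : ∀ w, τ w ∈ sphereInf
  inv_ne : ∀ w, τ w ≠ b
  right_inv : ∀ w, S (τ w) = w
  left_inv : ∀ x ∈ sphereInf, x ≠ b → τ (S x) = x
  norm_eq : ∀ x ∈ sphereInf, x ≠ b → ‖S x‖ = dist x a / (dist x b * dist a b)
  conformalAt : ∀ (f : ℂ → EuclideanSpace ℝ (Fin 3)) (z : ℂ), ConformalAt f z →
    (∀ w, ‖f w‖ = 1 ∧ f w ≠ b) → ConformalAt (fun w => S (f w)) z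

/-- Inversion about `b` sends the sphere to the plane `⟨b, y - b⟩ = -1/2`; translating the image of
`a` to `0` and identifying the plane with `ℂ` gives `S`. -/
theorem exists_isStereoChart {a b : CBall} (ha : a ∈ sphereInf) (hb : b ∈ sphereInf)
    (hab : a ≠ b) : ∃ S τ, IsStereoChart a b S τ := by
  have hbn : ‖(b : EuclideanSpace ℝ (Fin 3))‖ = 1 := hb
  have hb0 : (b : EuclideanSpace ℝ (Fin 3)) ≠ 0 := fun h => by simp [h] at hbn
  obtain ⟨L, hL, hL'⟩ := exists_linearIsometry_orthogonal hb0
  obtain ⟨J, hJ⟩ : ∃ J : EuclideanSpace ℝ (Fin 3) → EuclideanSpace ℝ (Fin 3),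
    J = EuclideanGeometry.inversion (b : EuclideanSpace ℝ (Fin 3)) 1 := ⟨_, rfl⟩
  have hJdef : ∀ x, J x = (1 / dist x (b : EuclideanSpace ℝ (Fin 3))) ^ 2 • (x - b) + b :=
    fun x => by rw [hJ]; rfl
  have hJJ : ∀ x, J (J x) = x := by
    rw [hJ]
    exact EuclideanGeometry.inversion_inversion _ one_ne_zero
  have hJc : ∀ x : EuclideanSpace ℝ (Fin 3), x ≠ b → ConformalAt J x := by
    intro x hx
    rw [hJ]
    refine ⟨_, EuclideanGeometry.hasFDerivAt_inversion hx, _, ?_,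
      (Submodule.reflection _).toLinearIsometry, rfl⟩
    have := (dist_pos.2 hx).ne'
    positivity
  have hinner : ∀ x : EuclideanSpace ℝ (Fin 3), ‖x‖ = 1 → x ≠ b →
      inner ℝ (b : EuclideanSpace ℝ (Fin 3)) (J x - b) = -(1 / 2) := by
    intro x hx hxb
    have hd : dist x (b : EuclideanSpace ℝ (Fin 3)) ≠ 0 := (dist_pos.2 hxb).ne'
    have hd2 : dist x (b : EuclideanSpace ℝ (Fin 3)) ^ 2 = 2 - 2 * inner ℝ (b : EuclideanSpace ℝ (Fin 3)) x := by
      rw [dist_eq_norm, norm_sub_sq_real, hx, hbn, real_inner_comm]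
      ring
    rw [hJdef, add_sub_cancel_right, inner_smul_right, inner_sub_right, real_inner_self_eq_norm_sq,
      hbn, div_pow, one_pow, one_div_mul_eq_div, div_eq_iff (pow_ne_zero 2 hd), hd2]
    ring
  obtain ⟨T, hT⟩ : ∃ T : EuclideanSpace ℝ (Fin 3) →L[ℝ] ℂ,
    T = ContinuousLinearMap.adjoint L.toContinuousLinearMap := ⟨_, rfl⟩
  have hTL : ∀ w, T (L w) = w := by
    intro w
    refine ext_inner_right ℝ fun v => ?_
    rw [hT, ContinuousLinearMap.adjoint_inner_left]
    exact L.inner_map_map w v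
  have hLT : ∀ y, inner ℝ (b : EuclideanSpace ℝ (Fin 3)) y = 0 → L (T y) = y := by
    intro y hy
    obtain ⟨w, rfl⟩ := hL' y hy
    rw [hTL]
  have han : ‖(a : EuclideanSpace ℝ (Fin 3))‖ = 1 := ha
  have habE : (a : EuclideanSpace ℝ (Fin 3)) ≠ b := fun h => hab (Subtype.ext h)
  have hLS : ∀ x : EuclideanSpace ℝ (Fin 3), ‖x‖ = 1 → x ≠ b → L (T (J x - J a)) = J x - J a := by
    intro x hx hxb
    apply hLT
    have : J x - J a = (J x - b) - (J a - b) := by abel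
    rw [this, inner_sub_right, hinner x hx hxb, hinner a han habE, sub_self]
  have hy : ∀ w, inner ℝ (b : EuclideanSpace ℝ (Fin 3)) (L w + J a - b) = -(1 / 2) := by
    intro w
    rw [add_sub_assoc, inner_add_right, hL, hinner a han habE, zero_add]
  have hyb : ∀ w, L w + J a ≠ b := by
    intro w h
    have := hy w
    rw [h, sub_self, inner_zero_right] at this
    norm_num at this
  have hτn : ∀ w, ‖J (L w + J a)‖ = 1 := by
    intro w
    have hd : dist (L w + J a) (b : EuclideanSpace ℝ (Fin 3)) ≠ 0 := (dist_pos.2 (hyb w)).ne'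
    have h2 : ‖J (L w + J a)‖ ^ 2 = 1 := by
      rw [hJdef, norm_add_sq_real, real_inner_comm, inner_smul_right, hy w, norm_smul, mul_pow, hbn,
        ← dist_eq_norm, norm_pow, norm_div, norm_one, Real.norm_of_nonneg dist_nonneg]
      field_simp
      ring
    nlinarith [norm_nonneg (J (L w + J a))]
  have hτb : ∀ w, J (L w + J a) ≠ b := by
    intro w h
    rw [hJ, EuclideanGeometry.inversion_eq_center one_ne_zero] at h
    exact hyb w (by rw [hJ]; exact h)
  refine ⟨fun x => T (J x - J a),
    fun w => ⟨J (L w + J a), mem_closedBall_zero_iff.2 (hτn w).le⟩, ?_⟩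
  constructor
  · intro x hx
    exact T.continuous.continuousAt.comp ((hJc x hx).differentiableAt.continuousAt.sub continuousAt_const)
  · refine Continuous.subtype_mk ?_ _
    rw [continuous_iff_continuousAt]
    intro w
    have h1 : ContinuousAt (fun w => L w + J a) w :=
      (L.continuous.add continuous_const).continuousAt
    exact ContinuousAt.comp (g := J) (hJc _ (hyb w)).differentiableAt.continuousAt h1
  · exact hτn
  · exact fun w h => hτb w (congrArg Subtype.val h)
  · intro w
    simp only
    rw [hJJ, add_sub_cancel_right, hTL]
  · intro x hx hxb
    apply Subtype.ext
    simp only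
    rw [hLS x hx (fun h => hxb (Subtype.ext h)), sub_add_cancel, hJJ]
  · intro x hx hxb
    have hxb' : (x : EuclideanSpace ℝ (Fin 3)) ≠ b := fun h => hxb (Subtype.ext h)
    rw [← L.norm_map, hLS x hx hxb', ← dist_eq_norm, hJ,
      EuclideanGeometry.dist_inversion_inversion hxb' habE, Subtype.dist_eq, Subtype.dist_eq,
      Subtype.dist_eq]
    ring
  -- The projection `T` is not conformal on 3-space, but `L ∘ T` is the identity on differences
  -- within the plane, so inner products survive for maps `f` into the sphere.
  · intro f z hf hfw
    obtain ⟨G, hG, hGc⟩ := (hJc _ (hfw z).2).comp z hf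
    have hh : HasFDerivAt (fun w => T (J (f w) - J a)) (T ∘L G) z :=
      T.hasFDerivAt.comp z (hG.sub_const (J a))
    have hLh : HasFDerivAt (fun w => L (T (J (f w) - J a)))
        (L.toContinuousLinearMap ∘L (T ∘L G)) z :=
      L.toContinuousLinearMap.hasFDerivAt.comp z hh
    have heq : (fun w => L (T (J (f w) - J a))) = fun w => J (f w) - J a :=
      funext fun w => hLS _ (hfw w).1 (hfw w).2
    rw [heq] at hLh
    have hGeq := hLh.unique (hG.sub_const (J a))
    refine ⟨_, hh, ?_⟩
    rw [isConformalMap_iff] at hGc ⊢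
    obtain ⟨k, hk, hGk⟩ := hGc
    refine ⟨k, hk, fun u v => ?_⟩
    rw [← hGk, ← L.inner_map_map]
    exact congrArg₂ (inner ℝ) (DFunLike.congr_fun hGeq u) (DFunLike.congr_fun hGeq v)

namespace IsStereoChart

variable {a b : CBall} {S : EuclideanSpace ℝ (Fin 3) → ℂ} {τ : ℂ → CBall}

theorem inv_zero (h : IsStereoChart a b S τ) (ha : a ∈ sphereInf) (hab : a ≠ b) : τ 0 = a := by
  have : S a = 0 := by
    rw [← norm_eq_zero, h.norm_eq a ha hab, dist_self, zero_div]
  rw [← this, h.left_inv a ha hab]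

theorem ne_zero (h : IsStereoChart a b S τ) {x : CBall} (hx : x ∈ sphereInf) (hxb : x ≠ b)
    (hxa : x ≠ a) (hab : a ≠ b) : S x ≠ 0 := by
  rw [← norm_pos_iff, h.norm_eq x hx hxb]
  have := dist_pos.2 hxb
  have := dist_pos.2 hxa
  have := dist_pos.2 hab
  positivity

theorem injOn (h : IsStereoChart a b S τ) {x y : CBall} (hx : x ∈ sphereInf) (hxb : x ≠ b)
    (hy : y ∈ sphereInf) (hyb : y ≠ b) (e : S x = S y) : x = y := by
  rw [← h.left_inv x hx hxb, e, h.left_inv y hy hyb]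

theorem dist_pole_le (h : IsStereoChart a b S τ) (hab : a ≠ b) (w : ℂ) :
    ‖w‖ * dist (τ w) b ≤ 2 / dist a b := by
  have h1 := h.norm_eq (τ w) (h.inv_mem w) (h.inv_ne w)
  have h2 := dist_pos.2 (h.inv_ne w)
  have h3 := dist_pos.2 hab
  have hd : dist (τ w) a ≤ 2 := by
    have := dist_triangle_right (τ w) a origin
    rw [dist_origin, dist_origin] at this
    linarith [norm_coe_le (τ w), norm_coe_le a]
  rw [h.right_inv] at h1
  rw [h1]
  calc dist (τ w) a / (dist (τ w) b * dist a b) * dist (τ w) b = dist (τ w) a / dist a b := by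
        field_simp
    _ ≤ 2 / dist a b := by gcongr

end IsStereoChart

/-! ## Loops with a logarithm do not separate -/

theorem isPreconnected_ball_inter_H3 (a : CBall) (r : ℝ) :
    IsPreconnected (Metric.ball a r ∩ H3) := by
  rw [← IsInducing.subtypeVal.isPreconnected_image]
  have : Subtype.val '' (Metric.ball a r ∩ H3) =
      Metric.ball (a : EuclideanSpace ℝ (Fin 3)) r ∩ Metric.ball 0 1 := by
    ext x
    constructor
    · rintro ⟨y, ⟨hy, hy'⟩, rfl⟩
      exact ⟨hy, mem_ball_zero_iff.2 hy'⟩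
    · rintro ⟨hx, hx'⟩
      exact ⟨⟨x, Metric.ball_subset_closedBall hx'⟩, ⟨hx, mem_ball_zero_iff.1 hx'⟩, rfl⟩
  rw [this]
  exact ((convex_ball _ _).inter (convex_ball _ _)).isPreconnected

/-- A path in the plane from `0` to a far point gives a path on the sphere from `a` to near `b`
avoiding `E`. By compactness a small radial contraction moves it into `H3` still off `E`; half-balls
at `a` and `b` are attached to it. -/
theorem exists_isPreconnected_of_not_isBounded {a b : CBall} (ha : a ∈ sphereInf) (hab : a ≠ b)
    {S : EuclideanSpace ℝ (Fin 3) → ℂ} {τ : ℂ → CBall} (hS : IsStereoChart a b S τ) {E : Set CBall}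
    (hE : IsClosed E) (haE : a ∉ E) (hbE : b ∉ E) {K : Set ℂ} (hK : IsClosed K)
    (hKE : ∀ w, w ∉ K → τ w ∉ E)
    (hunb : ¬ Bornology.IsBounded (connectedComponentIn Kᶜ 0)) :
    ∃ r > 0, ∃ Q : Set CBall, IsPreconnected Q ∧ Metric.ball a r ∩ H3 ⊆ Q ∧
      Metric.ball b r ∩ H3 ⊆ Q ∧ ∀ x ∈ Q, x ∈ H3 ∧ x ∉ E := by
  obtain ⟨r₁, hr₁, h1⟩ := Metric.isOpen_iff.1 hE.isOpen_compl a haE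
  obtain ⟨r₂, hr₂, h2⟩ := Metric.isOpen_iff.1 hE.isOpen_compl b hbE
  set r := min r₁ r₂ with hr
  have hr0 : 0 < r := lt_min hr₁ hr₂
  have hdab := dist_pos.2 hab
  set U := connectedComponentIn Kᶜ (0 : ℂ) with hU
  have hUo : IsOpen U := hK.isOpen_compl.connectedComponentIn
  have h0K : (0 : ℂ) ∈ Kᶜ := by
    by_contra h
    rw [hU, connectedComponentIn_eq_empty h] at hunb
    exact hunb Bornology.isBounded_empty
  have h0U : (0 : ℂ) ∈ U := mem_connectedComponentIn h0K
  have hUp : IsPathConnected U := hUo.isConnected_iff_isPathConnected.1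
    (isConnected_connectedComponentIn_iff.2 h0K)
  obtain ⟨w, hwU, hw⟩ : ∃ w ∈ U, 4 / dist a b / r < ‖w‖ := by
    by_contra hcon
    push Not at hcon
    exact hunb (isBounded_iff_forall_norm_le.2 ⟨_, hcon⟩)
  have hwb : dist (τ w) b < r / 2 := by
    have h3 := hS.dist_pole_le hab w
    have hw0 : 0 < ‖w‖ := lt_of_le_of_lt (by positivity) hw
    rw [div_lt_iff₀ hr0] at hw
    have h4 : ‖w‖ * dist (τ w) b < ‖w‖ * (r / 2) := by
      refine h3.trans_lt ?_
      have : 4 / dist a b = 2 * (2 / dist a b) := by ring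
      linarith
    exact lt_of_mul_lt_mul_left h4 hw0.le
  obtain ⟨γ, hγ⟩ := hUp.joinedIn 0 h0U w hwU
  set Q₀ : Set CBall := range fun s => τ (γ s) with hQ₀
  have hcont : Continuous fun s => τ (γ s) := hS.continuous_inv.comp γ.continuous
  have hdisj : Disjoint Q₀ E := by
    rw [Set.disjoint_left]
    rintro _ ⟨s, rfl⟩
    exact hKE _ (connectedComponentIn_subset _ _ (hγ s))
  obtain ⟨δ, hδ, hthick⟩ := hdisj.exists_thickenings (isCompact_range hcont) hE
  set η := min (1 / 2) (min (δ / 2) (r / 2)) with hη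
  have hη0 : 0 < η := by positivity
  have hη1 : η ≤ 1 / 2 := min_le_left _ _
  have hηδ : η ≤ δ / 2 := (min_le_right _ _).trans (min_le_left _ _)
  have hηr : η ≤ r / 2 := (min_le_right _ _).trans (min_le_right _ _)
  set t : unitInterval := ⟨1 - η, by linarith, by linarith⟩ with ht
  have hsh : ∀ x, dist (shrink t x) x ≤ η := fun x => by
    have := dist_shrink_le t x
    simp only [ht] at this
    linarith
  have ht1 : (t : ℝ) < 1 := by simp only [ht]; linarith
  set Q₁ : Set CBall := range fun s => shrink t (τ (γ s)) with hQ₁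
  have hQ₁p : IsPreconnected Q₁ := by
    rw [hQ₁]
    exact isPreconnected_range ((continuous_shrink.comp (Continuous.prodMk continuous_const hcont)))
  have hA : shrink t a ∈ Metric.ball a r ∩ H3 :=
    ⟨by rw [Metric.mem_ball]; linarith [hsh a], shrink_mem_H3 ht1 a⟩
  have hA' : shrink t a ∈ Q₁ := ⟨0, by simp only; rw [γ.source, hS.inv_zero ha hab]⟩
  have hB : shrink t (τ w) ∈ Metric.ball b r ∩ H3 :=
    ⟨by
      rw [Metric.mem_ball]
      have := dist_triangle (shrink t (τ w)) (τ w) b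
      linarith [hsh (τ w)], shrink_mem_H3 ht1 _⟩
  have hB' : shrink t (τ w) ∈ Q₁ := ⟨1, by simp only; rw [γ.target]⟩
  refine ⟨r, hr0, Metric.ball a r ∩ H3 ∪ Q₁ ∪ Metric.ball b r ∩ H3, ?_, ?_, ?_, ?_⟩
  · exact ((isPreconnected_ball_inter_H3 a r).union _ hA hA' hQ₁p).union _
      (Or.inr hB') hB (isPreconnected_ball_inter_H3 b r)
  · exact fun x hx => Or.inl (Or.inl hx)
  · exact fun x hx => Or.inr hx
  · rintro x ((hx | ⟨s, rfl⟩) | hx)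
    · exact ⟨hx.2, h1 (Metric.ball_subset_ball (min_le_left _ _) hx.1)⟩
    · refine ⟨shrink_mem_H3 ht1 _, fun hxE => ?_⟩
      have hmem : shrink t (τ (γ s)) ∈ Metric.thickening δ Q₀ :=
        Metric.mem_thickening_iff.2 ⟨_, ⟨s, rfl⟩, by linarith [hsh (τ (γ s))]⟩
      exact Set.disjoint_left.1 hthick hmem (Metric.self_subset_thickening hδ _ hxE)
    · exact ⟨hx.2, h2 (Metric.ball_subset_ball (min_le_right _ _) hx.1)⟩

/-- If the boundary loop of a closed set has a logarithm in a stereographic coordinate sending the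
ends of a geodesic to zero and infinity, then the set does not separate these ends. -/
theorem exists_isPreconnected_of_log {a b : CBall} (ha : a ∈ sphereInf)
    (hab : a ≠ b) {S : EuclideanSpace ℝ (Fin 3) → ℂ} {τ : ℂ → CBall} (hS : IsStereoChart a b S τ)
    {E : Set CBall} (hE : IsClosed E) (haE : a ∉ E) (hbE : b ∉ E) {v : unitInterval → CBall}
    (hv : Continuous v) (hvs : ∀ t, v t ∈ sphereInf) (hvE : ∀ t, v t ∈ E)
    (hEv : ∀ x ∈ E, x ∈ sphereInf → x ∈ range v) {φ : unitInterval → ℂ} (hφ : Continuous φ)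
    (hφS : ∀ t, Complex.exp (φ t) = S (v t)) (hφv : ∀ s t, v s = v t → φ s = φ t)
    {c : ℝ → CBall} (hc : IsUnitSpeed c) (hca : Tendsto (fun t => c (-t)) atTop (𝓝 a))
    (hcb : Tendsto c atTop (𝓝 b)) (T : ℝ) :
    ∃ s < -T, ∃ t > T, ∃ Q : Set CBall, IsPreconnected Q ∧ c s ∈ Q ∧ c t ∈ Q ∧
      ∀ x ∈ Q, x ∈ H3 ∧ x ∉ E := by
  have hvb : ∀ t, v t ≠ b := fun t h => hbE (h ▸ hvE t)
  have hcontS : Continuous fun t => S (v t) := by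
    rw [continuous_iff_continuousAt]
    intro t
    exact ContinuousAt.comp (f := fun t => (v t : EuclideanSpace ℝ (Fin 3)))
      (hS.continuousAt _ fun h => hvb t (Subtype.ext h))
      (continuous_subtype_val.comp hv).continuousAt
  set K : Set ℂ := range fun t => S (v t) with hK
  have hKc : IsCompact K := isCompact_range hcontS
  have h0K : (0 : ℂ) ∉ K := by
    rintro ⟨t, ht⟩
    simp only [← hφS] at ht
    exact Complex.exp_ne_zero _ ht
  set q : C(unitInterval, K) := ⟨fun t => ⟨S (v t), t, rfl⟩, hcontS.subtype_mk _⟩ with hq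
  have hqs : Function.Surjective q := by
    rintro ⟨_, t, rfl⟩
    exact ⟨t, rfl⟩
  -- By compactness the loop is a quotient map onto its image, so the logarithm along the parameter
  -- descends to the plane set `K`.
  have hqq : IsQuotientMap q := q.continuous.isClosedMap.isQuotientMap q.continuous hqs
  have hfac : Function.FactorsThrough φ q := by
    intro s t hst
    exact hφv s t (hS.injOn (hvs s) (hvb s) (hvs t) (hvb t) (congrArg Subtype.val hst))
  set κ : C(K, ℂ) := hqq.lift ⟨φ, hφ⟩ hfac with hκ
  have hκq : ∀ t, κ (q t) = φ t := fun t =>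
    DFunLike.congr_fun (hqq.lift_comp ⟨φ, hφ⟩ hfac) t
  have hκe : ∀ k : K, Complex.exp (κ k) = k := by
    intro k
    obtain ⟨t, rfl⟩ := hqs k
    rw [hκq, hφS]
    rfl
  obtain ⟨r, hr, Q, hQ, hQa, hQb, hQE⟩ := exists_isPreconnected_of_not_isBounded ha hab hS hE haE
    hbE hKc.isClosed (fun w hw hwE => hw (by
      obtain ⟨t, ht⟩ := hEv _ hwE (hS.inv_mem w)
      exact ⟨t, by simp only; rw [ht, hS.right_inv]⟩))
    (not_isBounded_connectedComponentIn_of_log hKc h0K κ hκe)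
  obtain ⟨t, ⟨h1, h2⟩, ht⟩ := (((hca.eventually_mem (Metric.ball_mem_nhds a hr)).and
    (hcb.eventually_mem (Metric.ball_mem_nhds b hr))).and (eventually_gt_atTop T)).exists
  exact ⟨-t, by linarith, t, ht, Q, hQ, hQa ⟨h1, hc.1 _⟩, hQb ⟨h2, hc.1 _⟩, hQE⟩

/-! ## The logarithm of a uniformization -/

theorem differentiableOn_of_exp_eq {U : Set ℂ} (hU : IsOpen U) {F Φ : ℂ → ℂ}
    (hF : ContinuousOn F U) (hΦ : DifferentiableOn ℂ Φ U)
    (h : ∀ z ∈ U, Complex.exp (F z) = Φ z) : DifferentiableOn ℂ F U := by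
  intro z hz
  have h1 : ∀ᶠ w in 𝓝 z, w ∈ U ∧ ‖F w - F z‖ < 1 := by
    have := (hF.continuousAt (hU.mem_nhds hz)) (Metric.ball_mem_nhds _ one_pos)
    filter_upwards [hU.mem_nhds hz, this] with w hw hw'
    exact ⟨hw, mem_ball_iff_norm.1 hw'⟩
  have hz0 : Φ z ≠ 0 := by rw [← h z hz]; exact Complex.exp_ne_zero _
  have h2 : F =ᶠ[𝓝 z] fun w => F z + Complex.log (Φ w / Φ z) := by
    filter_upwards [h1] with w hw
    have him := (Complex.abs_im_le_norm (F w - F z)).trans_lt hw.2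
    rw [abs_lt] at him
    have hpi := Real.pi_gt_three
    rw [← h w hw.1, ← h z hz, ← Complex.exp_sub, Complex.log_exp (by linarith) (by linarith)]
    ring
  refine (DifferentiableAt.congr_of_eventuallyEq ?_ h2).differentiableWithinAt
  have hd := (hΦ z hz).differentiableAt (hU.mem_nhds hz)
  refine (differentiableAt_const _).add ((hd.div_const _).clog ?_)
  rw [div_self hz0]
  exact Complex.one_mem_slitPlane

/-- In this coordinate `g` scales moduli by `exp l`, because the multipliers at `a` and `b` are
inverse to each other. -/
theorem IsStereoChart.norm_zpow_smul {a b : CBall} {S : EuclideanSpace ℝ (Fin 3) → ℂ}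
    {τ : ℂ → CBall} (hS : IsStereoChart a b S τ) (hab : a ≠ b) {g : IsoH3} {l : ℝ}
    (hga : g • a = a) (hgb : g • b = b) (hj : jac g a = Real.exp l) {p : CBall}
    (hp : p ∈ sphereInf) (hpb : p ≠ b) (n : ℤ) :
    ‖S ((g ^ n • p : CBall))‖ = Real.exp (n * l) * ‖S p‖ := by
  have hgan : g ^ n • a = a := by
    have : g ∈ MulAction.stabilizer IsoH3 a := hga
    exact (MulAction.stabilizer IsoH3 a).zpow_mem this n
  have hgbn : g ^ n • b = b := by
    have : g ∈ MulAction.stabilizer IsoH3 b := hgb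
    exact (MulAction.stabilizer IsoH3 b).zpow_mem this n
  have hjn : jac (g ^ n) a = Real.exp (n * l) := by
    obtain ⟨m, rfl | rfl⟩ := n.eq_nat_or_neg
    · rw [zpow_natCast, jac_pow_of_fixed hga, hj, ← Real.exp_nat_mul]
      simp
    · have h1 := jac_mul (g ^ (-(m : ℤ))) (g ^ m) a
      rw [zpow_neg, zpow_natCast, inv_mul_cancel, jac_one, pow_smul_of_fixed hga,
        jac_pow_of_fixed hga, hj, ← Real.exp_nat_mul] at h1
      rw [zpow_neg, zpow_natCast]
      refine mul_right_cancel₀ (Real.exp_pos (m * l)).ne' ?_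
      rw [← h1, ← Real.exp_add]
      simp
  have hjb := jac_mul_jac_eq_one (g := g ^ n) hab (by rw [hgan, hgbn])
  have hgp : g ^ n • p ∈ sphereInf := (smul_mem_sphereInf_iff _ _).2 hp
  have hgpb : g ^ n • p ≠ b := fun h => hpb (MulAction.injective (g ^ n) (h.trans hgbn.symm))
  rw [hS.norm_eq _ hgp hgpb, hS.norm_eq p hp hpb]
  have h1 := dist_smul_sq (g ^ n) p a
  have h2 := dist_smul_sq (g ^ n) p b
  rw [hgan] at h1
  rw [hgbn] at h2
  have hE := Real.exp_pos (n * l)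
  rw [hjn] at h1 hjb
  have hd1 := dist_pos.2 hgpb
  have hd2 := dist_pos.2 hpb
  have hd3 := dist_pos.2 hab
  have key : dist (g ^ n • p) a * dist p b = Real.exp (n * l) * dist p a * dist (g ^ n • p) b := by
    refine (sq_eq_sq₀ (by positivity) (by positivity)).1 ?_
    rw [mul_pow, mul_pow, mul_pow, h1, h2]
    linear_combination (-jac (g ^ n) p * Real.exp (n * l) * dist p a ^ 2 * dist p b ^ 2) * hjb
  field_simp
  linarith

/-- The logarithm of a uniformization in a coordinate adapted to the axis of a translation of
length `l` is Lipschitz with a constant depending only on `l`. -/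
theorem exists_log_uniformization {Γ : Subgroup IsoH3} {f : UpperHalfPlane → domainOfDiscontinuity Γ}
    (hf : IsUniformization Γ f) {a b : CBall} (ha : a ∈ limitSet Γ) (hb : b ∈ limitSet Γ)
    (hab : a ≠ b) {S : EuclideanSpace ℝ (Fin 3) → ℂ} {τ : ℂ → CBall} (hS : IsStereoChart a b S τ)
    {g : IsoH3} (hgΓ : g ∈ Γ) {l : ℝ} (hl : 0 < l) (hga : g • a = a) (hgb : g • b = b)
    (hj : jac g a = Real.exp l) {p : CBall} (hp : p ∈ limitSet Γ) (hpa : p ≠ a) (hpb : p ≠ b) :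
    ∃ F : UpperHalfPlane → ℂ, Continuous F ∧ (∀ z, Complex.exp (F z) = S (f z : CBall)) ∧
      ∀ z w : UpperHalfPlane, ‖(w : ℂ) - z‖ ≤ z.im / 2 →
        ‖F w - F z‖ * z.im ≤ 192 * (l + 2 * Real.pi) * ‖(w : ℂ) - z‖ := by
  set U : Set ℂ := {z | 0 < z.im} with hU
  have hUo : IsOpen U := isOpen_lt continuous_const Complex.continuous_im
  have hUc : Convex ℝ U := convex_halfSpace_im_gt 0
  have hUn : U.Nonempty := ⟨Complex.I, by simp [hU]⟩
  have hfs : ∀ z, (f z : CBall) ∈ sphereInf := fun z => (f z).2.1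
  have hfl : ∀ z, (f z : CBall) ∉ limitSet Γ := fun z => (f z).2.2
  have hfa : ∀ z, (f z : CBall) ≠ a := fun z h => hfl z (h ▸ ha)
  have hfb : ∀ z, (f z : CBall) ≠ b := fun z h => hfl z (h ▸ hb)
  set Φ : ℂ → ℂ := fun w => S ((f (UpperHalfPlane.ofComplex w) : CBall)) with hΦ
  have hΦz : ∀ z : UpperHalfPlane, Φ z = S (f z : CBall) := fun z => by
    simp only [hΦ, UpperHalfPlane.ofComplex_apply]
  have hΦ0 : ∀ w, Φ w ≠ 0 := fun w => hS.ne_zero (hfs _) (hfb _) (hfa _) hab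
  have hconf : ∀ z ∈ U, ConformalAt Φ z := fun z hz =>
    hS.conformalAt _ z (hf.2 ⟨z, hz⟩) fun w => ⟨hfs _, fun h => hfb _ (Subtype.ext h)⟩
  have hinj : ∀ z ∈ U, ∃ V ∈ 𝓝 z, InjOn Φ V := by
    intro z hz
    obtain ⟨e, hze, he⟩ := hf.1.isLocalHomeomorph ⟨z, hz⟩
    refine ⟨UpperHalfPlane.coe '' e.source,
      (UpperHalfPlane.isOpenEmbedding_coe.isOpenMap _ e.open_source).mem_nhds ⟨_, hze, rfl⟩, ?_⟩
    rintro _ ⟨z₁, h1, rfl⟩ _ ⟨z₂, h2, rfl⟩ h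
    rw [hΦz, hΦz] at h
    have h3 : f z₁ = f z₂ := Subtype.ext (hS.injOn (hfs _) (hfb _) (hfs _) (hfb _) h)
    rw [he] at h3
    rw [e.injOn h1 h2 h3]
  have hS0 : S p ≠ 0 := hS.ne_zero hp.1 hpb hpa hab
  -- The orbit of `p` under `g` consists of limit points, which `f` misses.
  have homit : ∀ n : ℤ, ‖S (g ^ n • p : CBall)‖ = Real.exp (n * l) * ‖S p‖ ∧
      ∀ w, Φ w ≠ S (g ^ n • p : CBall) := by
    intro n
    refine ⟨hS.norm_zpow_smul hab hga hgb hj hp.1 hpb n, fun w h => ?_⟩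
    have hgp : g ^ n • p ∈ limitSet Γ := smul_mem_limitSet (Γ.zpow_mem hgΓ n) hp
    have hgbn : g ^ n • b = b := by
      have : g ∈ MulAction.stabilizer IsoH3 b := hgb
      exact (MulAction.stabilizer IsoH3 b).zpow_mem this n
    have hgpb : g ^ n • p ≠ b := fun h => hpb (MulAction.injective (g ^ n) (h.trans hgbn.symm))
    have := hS.injOn (hfs _) (hfb _) hgp.1 hgpb h
    exact hfl _ (this ▸ hgp)
  have hcoe : ∀ {F : ℂ → ℂ}, ContinuousOn F U → Continuous fun z : UpperHalfPlane => F z :=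
    fun hF => hF.comp_continuous UpperHalfPlane.continuous_coe fun z => z.im_pos
  obtain hd | hd := differentiableOn_or_of_conformalAt hUo hUc.isPreconnected hconf hinj
  · obtain ⟨F, hF, hFe⟩ := exists_continuousOn_log hUo hUc hUn hd.continuousOn (fun w _ => hΦ0 w)
    refine ⟨fun z => F z, hcoe hF, fun z => by rw [hFe z z.im_pos, hΦz], fun z w hzw => ?_⟩
    refine norm_log_sub_le_of_omits (differentiableOn_of_exp_eq hUo hF hd hFe) hl
      (norm_pos_iff.2 hS0) (fun n => ⟨_, (homit n).1, fun w hw h => (homit n).2 w ?_⟩) z.im_pos hzw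
    rw [← h, hFe w hw]
  -- Antiholomorphic case: take the logarithm of the conjugate and conjugate back.
  · obtain ⟨F, hF, hFe⟩ := exists_continuousOn_log hUo hUc hUn hd.continuousOn
      (fun w _ => (map_ne_zero _).2 (hΦ0 w))
    refine ⟨fun z => starRingEnd ℂ (F z), Complex.continuous_conj.comp (hcoe hF), fun z => ?_,
      fun z w hzw => ?_⟩
    · rw [Complex.exp_conj, hFe z z.im_pos, Complex.conj_conj, hΦz]
    · rw [← map_sub, Complex.norm_conj]
      refine norm_log_sub_le_of_omits (differentiableOn_of_exp_eq hUo hF hd hFe) hl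
        (norm_pos_iff.2 hS0) (fun n => ⟨starRingEnd ℂ (S (g ^ n • p : CBall)), ?_,
          fun w hw h => (homit n).2 w ?_⟩) z.im_pos hzw
      · rw [Complex.norm_conj, (homit n).1]
      · rw [hFe w hw] at h
        exact (starRingEnd ℂ).injective h

/-- Two points of a short arc at which the logarithm of a uniformization differs by a nontrivial
period force the translation to be long. -/
theorem lt_of_exp_eq_of_ne {F : UpperHalfPlane → ℂ} {l ε : ℝ} (hl : 0 < l) (hε : 0 < ε)
    (hF : ∀ z w : UpperHalfPlane, ‖(w : ℂ) - z‖ ≤ z.im / 2 →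
      ‖F w - F z‖ * z.im ≤ 192 * (l + 2 * Real.pi) * ‖(w : ℂ) - z‖) {z w : UpperHalfPlane}
    (hd : dist w z ≤ 2 * ε) (he : Complex.exp (F w) = Complex.exp (F z)) (hne : F w ≠ F z) :
    1 / (128 * ε) - 7 < l := by
  have hpi3 := Real.pi_gt_three
  have hpi4 := Real.pi_lt_d2
  obtain hbig | hsmall := lt_or_ge (1 / 8) ε
  · have : 1 / (128 * ε) < 1 := by rw [div_lt_one (by positivity)]; linarith
    linarith
  have h1 := UpperHalfPlane.dist_coe_le w z
  have h2 : Real.exp (dist w z) - 1 ≤ 4 * ε := by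
    have := Real.abs_exp_sub_one_le (x := dist w z) (by
      rw [abs_of_nonneg dist_nonneg]; linarith)
    rw [abs_of_nonneg (dist_nonneg (x := w))] at this
    linarith [le_abs_self (Real.exp (dist w z) - 1)]
  have hz := z.im_pos
  have h3 : ‖(w : ℂ) - z‖ ≤ z.im * (4 * ε) := by
    rw [← dist_eq_norm]
    exact h1.trans (by gcongr)
  have h4 := hF z w (h3.trans (by nlinarith))
  have h5 : 2 * Real.pi ≤ ‖F w - F z‖ := by
    obtain ⟨n, hn⟩ := Complex.exp_eq_exp_iff_exists_int.1 he
    have hn' : F w - F z = n * (2 * Real.pi * Complex.I) := by rw [hn]; ring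
    have hn0 : n ≠ 0 := by
      rintro rfl
      simp at hn
      exact hne hn
    have h6 : (1 : ℝ) ≤ |(n : ℝ)| := by exact_mod_cast Int.one_le_abs hn0
    rw [hn']
    have : ‖(n : ℂ) * (2 * Real.pi * Complex.I)‖ = |(n : ℝ)| * (2 * Real.pi) := by
      simp [abs_of_pos Real.pi_pos]
    rw [this]
    nlinarith
  have h6 : 2 * Real.pi * z.im ≤ 768 * (l + 2 * Real.pi) * ε * z.im :=
    calc 2 * Real.pi * z.im ≤ ‖F w - F z‖ * z.im := by gcongr
      _ ≤ _ := h4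
      _ ≤ 192 * (l + 2 * Real.pi) * (z.im * (4 * ε)) := by gcongr
      _ = _ := by ring
  have h7 : 2 * Real.pi ≤ 768 * (l + 2 * Real.pi) * ε := le_of_mul_le_mul_right h6 hz
  -- Division of `h7` by `2π`, using `2π > 6`, `768 / 6 = 128` and `2π < 7`.
  have h8 : 1 < (l + 7) * (128 * ε) := by nlinarith
  have h9 : 1 / (128 * ε) < l + 7 := by rwa [div_lt_iff₀ (by positivity)]
  linarith

/-! ## Lifts of meridians and disks -/

section

variable {Γ : Subgroup IsoH3}

theorem mem_H3_of_proj_mem {x : bordification Γ} (h : proj Γ x ∈ hypManifold Γ) :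
    (x : CBall) ∈ H3 := by
  obtain ⟨y, hy, hxy⟩ := h
  obtain ⟨g, -, hg⟩ := exists_smul_of_proj_eq hxy.symm
  rw [hg]
  exact (smul_mem_H3_iff g _).2 hy

theorem exists_uniformization_of_conformalLength_lt {m : C(Circle, conformalBoundary Γ)}
    {L : ℝ≥0∞} (h : conformalLength m < L) :
    ∃ f : UpperHalfPlane → domainOfDiscontinuity Γ, IsUniformization Γ f ∧
      ∃ κ : C(unitInterval, UpperHalfPlane),
        (∀ t : unitInterval,
          proj Γ (ofDomain (f (κ t))) = (m (Circle.exp (2 * Real.pi * (t : ℝ))) : MBar Γ)) ∧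
        eVariationOn κ univ < L := by
  simp only [conformalLength, iInf_lt_iff] at h
  obtain ⟨f, hf, κ, hκ, h⟩ := h
  exact ⟨f, hf, κ, hκ, h⟩

/-- The boundary parametrization of the closed disk by the unit interval. -/
noncomputable def diskBoundary (t : unitInterval) : Disk :=
  ⟨Circle.exp (2 * Real.pi * (t : ℝ)), mem_closedBall_zero_iff.2 (Circle.norm_coe _).le⟩

theorem continuous_diskBoundary : Continuous diskBoundary := by
  unfold diskBoundary
  fun_prop

theorem diskBoundary_zero : diskBoundary 0 = diskBoundary 1 := by
  apply Subtype.ext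
  simp [diskBoundary]

theorem exists_diskBoundary_eq {z : Disk} (hz : ‖(z : ℂ)‖ = 1) : ∃ t, diskBoundary t = z := by
  have hpi := Real.two_pi_pos
  set x := Complex.arg z / (2 * Real.pi) with hx
  refine ⟨⟨Int.fract x, Int.fract_nonneg _, (Int.fract_lt_one _).le⟩, Subtype.ext ?_⟩
  have h1 : 2 * Real.pi * Int.fract x = Complex.arg z - ⌊x⌋ * (2 * Real.pi) := by
    rw [Int.fract, mul_sub, hx, mul_div_cancel₀ _ hpi.ne']
    ring
  simp only [diskBoundary, Circle.coe_exp, h1]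
  push_cast
  rw [sub_mul, Complex.exp_sub, mul_assoc (⌊x⌋ : ℂ), Complex.exp_int_mul_two_pi_mul_I, div_one]
  have := Complex.norm_mul_exp_arg_mul_I (z : ℂ)
  rwa [hz, Complex.ofReal_one, one_mul] at this

theorem eq_or_of_diskBoundary_eq {s t : unitInterval} (h : diskBoundary s = diskBoundary t) :
    s = t ∨ (s = 0 ∧ t = 1) ∨ (s = 1 ∧ t = 0) := by
  have h0 : ((Circle.exp (2 * Real.pi * (s : ℝ)) : Circle) : ℂ)
      = Circle.exp (2 * Real.pi * (t : ℝ)) :=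
    congrArg (fun z : Disk => (z : ℂ)) h
  have h1 : Circle.exp (2 * Real.pi * (s : ℝ)) = Circle.exp (2 * Real.pi * (t : ℝ)) :=
    Circle.ext h0
  obtain ⟨n, hn⟩ := Circle.exp_eq_exp.1 h1
  have hpi := Real.two_pi_pos
  have h2 : (s : ℝ) = t + n := by
    refine mul_left_cancel₀ hpi.ne' ?_
    rw [hn]
    ring
  have hs := s.2
  have ht := t.2
  have hn1 : n ≤ 1 := by
    have : (n : ℝ) ≤ 1 := by linarith [hs.2, ht.1]
    exact_mod_cast this
  have hn2 : -1 ≤ n := by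
    have : (-1 : ℝ) ≤ n := by linarith [hs.1, ht.2]
    exact_mod_cast this
  obtain rfl | rfl | rfl : n = -1 ∨ n = 0 ∨ n = 1 := by omega
  · right; left
    push_cast at h2
    exact ⟨Subtype.ext (le_antisymm (show (s : ℝ) ≤ 0 by linarith [ht.2]) hs.1),
      Subtype.ext (le_antisymm ht.2 (show (1 : ℝ) ≤ t by linarith [hs.1]))⟩
  · left
    exact Subtype.ext (by simpa using h2)
  · right; right
    push_cast at h2
    exact ⟨Subtype.ext (le_antisymm hs.2 (show (1 : ℝ) ≤ s by linarith [ht.1])),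
      Subtype.ext (le_antisymm (show (t : ℝ) ≤ 0 by linarith [hs.2]) ht.1)⟩

/-- The axis of a closed geodesic: a lift is translated by an element of the group. -/
theorem exists_translation (hΓ : IsDiscreteGroup Γ) (htf : IsTorsionFreeGroup Γ)
    {c : ℝ → bordification Γ} (hc : IsUnitSpeed fun t => (c t : CBall)) {l : ℝ}
    (hper : ∀ t, proj Γ (c (t + l)) = proj Γ (c t)) :
    ∃ g ∈ Γ, ∀ t, (c (t + l) : CBall) = g • (c t : CBall) :=
  exists_smul_eq_of_forall hΓ htf (u := fun t => (c (t + l) : CBall)) (v := fun t => (c t : CBall))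
    (hc.continuous.comp (continuous_id.add continuous_const)) hc.continuous
    (fun t => (c (t + l)).2) (fun t => (c t).2) (fun t => exists_smul_of_proj_eq (hper t))

theorem exists_axis (hΓ : IsDiscreteGroup Γ) (htf : IsTorsionFreeGroup Γ)
    (hna : ¬ ∀ g ∈ Γ, ∀ h ∈ Γ, g * h = h * g) {c : ℝ → CBall} (hc : IsUnitSpeed c) {g : IsoH3}
    (hgΓ : g ∈ Γ) {l : ℝ} (hl : 0 < l) (hgc : ∀ t, c (t + l) = g • c t) :
    ∃ a ∈ limitSet Γ, ∃ b ∈ limitSet Γ, a ≠ b ∧ Tendsto (fun t => c (-t)) atTop (𝓝 a) ∧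
      Tendsto c atTop (𝓝 b) ∧ g • a = a ∧ g • b = b ∧ jac g a = Real.exp l ∧
      ∃ p ∈ limitSet Γ, p ≠ a ∧ p ≠ b := by
  obtain ⟨b, hbs, hcb⟩ := hc.exists_tendsto
  obtain ⟨a, has, hca⟩ := hc.comp_neg.exists_tendsto
  have hab : a ≠ b := hc.ends_ne has hbs hca hcb
  have hneg := IsUnitSpeed.neg_translate hgc
  have hb : b ∈ limitSet Γ := hc.end_mem_limitSet hl hgc hgΓ hbs hcb
  have ha : a ∈ limitSet Γ := hc.comp_neg.end_mem_limitSet hl hneg (Γ.inv_mem hgΓ) has hca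
  have hga : g • a = a := by
    have : g⁻¹ • a = a := IsUnitSpeed.fixes_end (c := fun t => c (-t)) hneg hca
    rw [inv_smul_eq_iff] at this
    exact this.symm
  exact ⟨a, ha, b, hb, hab, hca, hcb, hga, IsUnitSpeed.fixes_end hgc hcb, hc.jac_end hgc has hca,
    exists_mem_limitSet_ne hΓ htf hna ha hb hab⟩

set_option maxHeartbeats 1600000 in
theorem length_gt_of_crosses (hΓ : IsDiscreteGroup Γ) (htf : IsTorsionFreeGroup Γ)
    (hna : ¬ ∀ g ∈ Γ, ∀ h ∈ Γ, g * h = h * g) {m : C(Circle, conformalBoundary Γ)}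
    {D : C(Disk, MBar Γ)} (hD : IsCompressionDisk m D) {ε : ℝ} (hε : 0 < ε)
    (hm : conformalLength m = ENNReal.ofReal ε) {γ : ℝ → MBar Γ} {l : ℝ}
    (hγ : IsClosedGeodesic γ l) (hcr : Crosses γ D) : 1 / (128 * ε) - 7 < l := by
  obtain ⟨hl, hper, -⟩ := hγ
  obtain ⟨D', c, hD', hc, hcγ, T, hT⟩ := hcr
  -- The infimum need not be known to be attained, hence the slack `2 * ε`; its finiteness already
  -- provides a uniformization and a lift.
  obtain ⟨f, hf, κ, hκ, hvar⟩ := exists_uniformization_of_conformalLength_lt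
    (m := m) (L := ENNReal.ofReal (2 * ε))
    (by rw [hm]; exact (ENNReal.ofReal_lt_ofReal_iff (by positivity)).2 (by linarith))
  -- the two lifts of the meridian differ by an element of the group
  have hDc : Continuous fun z => (D' z : CBall) := continuous_subtype_val.comp D'.continuous
  have hbd : ∀ t, proj Γ (D' (diskBoundary t)) =
      (m (Circle.exp (2 * Real.pi * (t : ℝ))) : MBar Γ) := fun t => by
    rw [hD']
    exact hD.2.2 _ _ rfl
  obtain ⟨h, hh, hfh'⟩ := exists_smul_eq_of_forall hΓ htf
    (u := fun t => (f (κ t) : CBall)) (v := fun t => (D' (diskBoundary t) : CBall))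
    (continuous_subtype_val.comp (hf.1.continuous.comp κ.continuous))
    (hDc.comp continuous_diskBoundary) (fun t => (f (κ t)).2.2) (fun t => (D' (diskBoundary t)).2)
    (fun t => exists_smul_of_proj_eq (x := ofDomain (f (κ t))) (by rw [hbd, hκ]))
  have hfh : ∀ t, (f (κ t) : CBall) = h • (D' (diskBoundary t) : CBall) := hfh'
  have hDinj : Function.Injective fun z => (D' z : CBall) := fun z w e => hD.1 (by
    rw [← hD', ← hD', Subtype.ext e])
  -- the translated lift of the geodesic and its axis
  have hcu : IsUnitSpeed fun t => (c t : CBall) := hc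
  obtain ⟨g₀, hg₀, hg₀c⟩ := exists_translation hΓ htf hcu (l := l)
    (fun t => by rw [hcγ, hcγ, hper])
  obtain ⟨c', hc'⟩ : ∃ c' : ℝ → CBall, c' = fun t => h • (c t : CBall) := ⟨_, rfl⟩
  have hcu' : IsUnitSpeed c' := hc' ▸ hcu.smul h
  obtain ⟨g, hg⟩ : ∃ g, g = h * g₀ * h⁻¹ := ⟨_, rfl⟩
  have hgΓ : g ∈ Γ := hg ▸ Γ.mul_mem (Γ.mul_mem hh hg₀) (Γ.inv_mem hh)
  have hgc : ∀ t, c' (t + l) = g • c' t := by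
    intro t
    simp only [hc', hg, hg₀c, mul_smul, inv_smul_smul]
  obtain ⟨a, ha, b, hb, hab, hca, hcb, hga, hgb, hj, p, hp, hpa, hpb⟩ :=
    exists_axis hΓ htf hna hcu' hgΓ hl hgc
  obtain ⟨S, τ, hS⟩ := exists_isStereoChart ha.1 hb.1 hab
  obtain ⟨F, hF, hFe, hFl⟩ := exists_log_uniformization hf ha hb hab hS hgΓ hl hga hgb hj hp hpa hpb
  have hends : (f (κ 1) : CBall) = f (κ 0) := by
    rw [hfh 1, hfh 0]
    exact congrArg (fun z => h • (D' z : CBall)) diskBoundary_zero.symm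
  -- The path `κ` need not close up, although its image under `f` does. It remains to exclude that
  -- `F` agrees at its two ends.
  refine lt_of_exp_eq_of_ne hl hε hFl (z := κ 0) (w := κ 1) ?_ (by rw [hFe (κ 1), hFe (κ 0), hends])
    fun hFeq => ?_
  · have h1 := (eVariationOn.edist_le (κ : unitInterval → UpperHalfPlane) (mem_univ 1)
      (mem_univ 0)).trans hvar.le
    rw [edist_dist] at h1
    exact (ENNReal.ofReal_le_ofReal_iff (by positivity)).1 h1
  -- otherwise the disk does not separate the ends of the geodesic
  obtain ⟨E, hE⟩ : ∃ E : Set CBall, E = range fun z => h • (D' z : CBall) := ⟨_, rfl⟩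
  have hEc : IsClosed E := hE ▸ (isCompact_range ((continuous_smul_iso h).comp hDc)).isClosed
  have hlim : ∀ x ∈ limitSet Γ, x ∉ E := by
    rintro x hx hxE
    rw [hE] at hxE
    obtain ⟨z, rfl⟩ := hxE
    have := smul_mem_limitSet (Γ.inv_mem hh) hx
    simp only [inv_smul_smul] at this
    exact (D' z).2 this
  have hEv : ∀ x ∈ E, x ∈ sphereInf → x ∈ range fun t => (f (κ t) : CBall) := by
    intro x hxE hz
    rw [hE] at hxE
    obtain ⟨z, rfl⟩ := hxE
    simp only [smul_mem_sphereInf_iff] at hz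
    have hz1 : ‖(z : ℂ)‖ = 1 := by
      by_contra hne
      have hlt : ‖(z : ℂ)‖ < 1 := lt_of_le_of_ne (mem_closedBall_zero_iff.1 z.2) hne
      have := hD.2.1 z hlt
      rw [← hD'] at this
      exact mem_sphereInf_iff_notMem_H3.1 hz (mem_H3_of_proj_mem this)
    obtain ⟨t, ht⟩ := exists_diskBoundary_eq hz1
    exact ⟨t, (hfh t).trans (congrArg (fun z => h • (D' z : CBall)) ht)⟩
  -- The lifted disk is embedded, so the loop repeats only at the parameters `0` and `1`, where
  -- `hFeq` applies.
  have hφv : ∀ s t, (f (κ s) : CBall) = f (κ t) → F (κ s) = F (κ t) := by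
    intro s t e
    have e' : diskBoundary s = diskBoundary t :=
      hDinj (MulAction.injective h (((hfh s).symm.trans e).trans (hfh t)))
    obtain h1 | ⟨h1, h2⟩ | ⟨h1, h2⟩ := eq_or_of_diskBoundary_eq e'
    · rw [h1]
    · rw [h1, h2, hFeq]
    · rw [h1, h2, hFeq]
  have hvE : ∀ t, (f (κ t) : CBall) ∈ E := fun t => hE ▸ ⟨diskBoundary t, (hfh t).symm⟩
  have hvc : Continuous fun t => (f (κ t) : CBall) :=
    continuous_subtype_val.comp (hf.1.continuous.comp κ.continuous)
  obtain ⟨s, hs, t, ht, Q, hQ, hQs, hQt, hQE⟩ := exists_isPreconnected_of_log ha.1 hab hS hEc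
    (hlim a ha) (hlim b hb) (v := fun t => (f (κ t) : CBall)) (φ := fun t => F (κ t))
    hvc (fun t => (f (κ t)).2.1) hvE hEv
    (hF.comp κ.continuous) (fun t => hFe _)
    hφv hcu' hca hcb T
  -- Carried back by `h⁻¹`, the connected set joins both ends of the original lift in the complement
  -- of `D'`, contradicting the crossing.
  have hQ' : IsPreconnected ((fun x : CBall => h⁻¹ • x) '' Q) :=
    hQ.image _ (continuous_smul_iso h⁻¹).continuousOn
  have hsub : (fun x : CBall => h⁻¹ • x) '' Q ⊆ diskComplement D' := by
    rintro _ ⟨x, hx, rfl⟩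
    refine ⟨(smul_mem_H3_iff _ _).2 (hQE x hx).1, fun z hz => (hQE x hx).2 (hE ▸ ⟨z, ?_⟩)⟩
    simp only
    rw [hz, smul_inv_smul]
  have hmem : ∀ u, c' u ∈ Q → (c u : CBall) ∈ (fun x : CBall => h⁻¹ • x) '' Q := fun u hu =>
    ⟨c' u, hu, by rw [hc']; exact inv_smul_smul _ _⟩
  exact (hT s hs t ht).2.2
    (hQ'.subset_connectedComponentIn (hmem s hQs) hsub (hmem t hQt))

end

end HypThree

open HypThree
theorem mainTheorem10 :
    ∃ K : ℝ → ℝ, Tendsto K (𝓝[>] 0) atTop ∧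
      ∀ Γ : Subgroup IsoH3, IsDiscreteGroup Γ → IsTorsionFreeGroup Γ →
        (¬ ∀ g ∈ Γ, ∀ h ∈ Γ, g * h = h * g) →
      ∀ (m : C(Circle, conformalBoundary Γ)) (D : C(Disk, MBar Γ)),
        IsMeridian m → IsCompressionDisk m D →
      ∀ ε : ℝ, 0 < ε → conformalLength m = ENNReal.ofReal ε →
      ∀ (γ : ℝ → MBar Γ) (l : ℝ), IsClosedGeodesic γ l → Crosses γ D → K ε < l := by
  refine ⟨fun ε => 1 / (128 * ε) - 7, ?_, ?_⟩
  · have h : Tendsto (fun ε : ℝ => 1 / 128 * ε⁻¹ + -7) (𝓝[>] 0) atTop :=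
      tendsto_atTop_add_const_right _ _
        (tendsto_inv_nhdsGT_zero.const_mul_atTop (by norm_num))
    refine h.congr fun ε => ?_
    rw [one_div, one_div, mul_inv]
    ring
  · intro Γ hΓ htf hna m D _ hD ε hε hm γ l hγ hcr
    exact length_gt_of_crosses hΓ htf hna hD hε hm hγ hcr
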